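/- Let $Y_1,Y_2,\ldots$ be independent random variables with values in $\{0,1\}$ and $p_\ell=\mathbb{P}(Y_\ell=1)\in(0,1)$. Suppose that $(p_\ell)$ is periodic with period length $r\ge 1$, i.e. $r$ is the least positive integer with $p_{mr+\ell}=p_\ell$ for all $\ell,m$. Let $d\ge 1$ be an integer, and put $q=\lfloor (d-1)/2\rfloor$ and $\omega_j=2\pi j/d$. For $1\le i\le d$ let $$Z_i^n=\frac1{\lfloor n/d\rfloor}\sum_{k=0}^{\lfloor n/d\rfloor-1}Y_{i+kd},\qquad e_i=\frac1r\sum_{k=0}^{r-1}p_{i+kd},\qquad v_i=\frac1r\sum_{k=0}^{r-1}\mathrm{Var}(Y_{i+kd}),$$ and $Z^n=(Z_1^n,\ldots,Z_d^n)$. For $x\in\mathbb{R}^d$ let $$I_x(\omega_j)=\frac1d\Bigl|\sum_{\ell=1}^d x_\ell e^{-i\ell\omega_j}\Bigr|^2,\qquad A=\{x\in\mathbb{R}^d : I_x(\omega_1)=\cdots=I_x(\omega_q)=0\},$$ $$g(x)=\frac{\max_{1\le j\le q}I_x(\omega_j)}{\sum_{m=1}^q I_x(\omega_m)},\qquad f(x)=g(x)\,\mathbf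 1_{\{x\notin A\}}.$$ (If $d\le 2$, then $q=0$, $A=\mathbb{R}^d$, and $g$ and $f$ are understood to be identically $0$.) Let $N_1,\ldots,N_d$ be i.i.d. standard normal random variables. Theorem. Suppose that $r$ and $d$ are coprime. Then: (i) $(e_1,\ldots,e_d)\in A$. (ii) $\lim_{n\to\infty}\mathrm{Var}\bigl(\sqrt{\lfloor n/d\rfloor}\,Z_i^n\bigr)=v_i$ for every $1\le i\le d$, and $v_1=\cdots=v_d$. (iii) If $d\ge 3$, then $(N_1,\ldots,N_d)\notin A$ almost surely, so that $g(N_1,\ldots,N_d)$ is almost surely well defined; and $f(Z^n)$ converges in law to $g(N_1,\ldots,N_d)$ as $n\to\infty$. The case $r=1$ is the null hypothesis of a constant success probability, so the limit law is the same as under the null hypothesis. (iv) The test has no asymptotic power: for every $\alpha\in(0,1)$ and every solution $k_\alpha\in\mathbb{R}$ of $$\sum_{j=1}^q(-1)^{j+1}\binom qj(1-jk_\alpha)_+^{q-1}=\alpha$$ (where $x_+=\max\{x,0\}$ and $0^0=1$), the rejection probability satisfies $\mathbb{P}\bigl(f(Z^n)>k_\alpha\bigr)\to\alpha$ as $n\to\infty$.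 -/

import Mathlib

open MeasureTheory ProbabilityTheory Filter Topology
open scoped BigOperators

/-! Sequences are indexed from `0`: `Y ℓ` and `p ℓ` stand for the `(ℓ+1)`-st observation and its
success probability, and the index `i : Fin d` stands for the `(i+1)`-st coordinate. -/

noncomputable section

/-- `r` is the period length of `p`: the least positive integer `s` with
`p (m s + ℓ) = p ℓ` for all `ℓ` and `m`. -/
def IsPeriodLength (p : ℕ → ℝ) (r : ℕ) : Prop :=
  IsLeast {s : ℕ | 0 < s ∧ ∀ ℓ m : ℕ, p (m * s + ℓ) = p ℓ} r

/-- `Y` is an independent sequence of `{0,1}`-valued random variables with success probabilities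
`p ℓ = P(Y ℓ = 1) ∈ (0,1)`, where `p` is periodic with (minimal) period length `r`. -/
structure IsPeriodicBinarySeries {Ω : Type*} [MeasurableSpace Ω] (μ : Measure Ω)
    (Y : ℕ → Ω → ℝ) (p : ℕ → ℝ) (r : ℕ) : Prop where
  measurable : ∀ ℓ, Measurable (Y ℓ)
  indep : iIndepFun Y μ
  binary : ∀ ℓ ω, Y ℓ ω = 0 ∨ Y ℓ ω = 1
  prob_eq : ∀ ℓ, p ℓ = μ.real {ω | Y ℓ ω = 1}
  prob_mem : ∀ ℓ, p ℓ ∈ Set.Ioo (0 : ℝ) 1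
  period : IsPeriodLength p r

/-- The time series `Z^n = (Z_1^n, …, Z_d^n)` of block means. -/
def blockMean {Ω : Type*} (Y : ℕ → Ω → ℝ) (d n : ℕ) (ω : Ω) : Fin d → ℝ :=
  fun i => (1 / ((n / d : ℕ) : ℝ)) * ∑ k ∈ Finset.range (n / d), Y (i + k * d) ω

/-- The limits `e_i = (1/r) ∑_{k<r} p_{i+kd}`. -/
def limitMean (p : ℕ → ℝ) (r d : ℕ) : Fin d → ℝ :=
  fun i => (1 / (r : ℝ)) * ∑ k ∈ Finset.range r, p (i + k * d)

/-- The limiting variances `v_i = (1/r) ∑_{k<r} Var(Y_{i+kd})`. -/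
def limitVariance {Ω : Type*} [MeasurableSpace Ω] (μ : Measure Ω) (Y : ℕ → Ω → ℝ)
    (r d : ℕ) : Fin d → ℝ :=
  fun i => (1 / (r : ℝ)) * ∑ k ∈ Finset.range r, variance (Y (i + k * d)) μ

/-- The number `q = ⌊(d-1)/2⌋` of frequencies (for `d ≥ 1`). -/
def numFreq (d : ℕ) : ℕ := (d - 1) / 2

/-- The Fourier frequency `ω_j = 2πj/d`. -/
def fourierFreq (d j : ℕ) : ℝ := 2 * Real.pi * j / d

/-- The periodogram `I_x(ω_j) = (1/d) |∑_{ℓ=1}^d x_ℓ exp(-i ℓ ω_j)|²`. -/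
def periodogram {d : ℕ} (x : Fin d → ℝ) (j : ℕ) : ℝ :=
  (1 / (d : ℝ)) *
    ‖∑ ℓ : Fin d, (x ℓ : ℂ) *
      Complex.exp (-Complex.I * (((ℓ : ℕ) + 1 : ℕ) : ℂ) * (fourierFreq d j : ℂ))‖ ^ 2

/-- The set `A` of those `x` for which `I_x(ω_1) = … = I_x(ω_q) = 0`. -/
def vanishingSet (d : ℕ) : Set (Fin d → ℝ) :=
  {x | ∀ j ∈ Finset.Icc 1 (numFreq d), periodogram x j = 0}

/-- Fisher's statistic `g(x) = max_{1≤j≤q} I_x(ω_j) / ∑_{m=1}^q I_x(ω_m)`. The supremum runs over a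
finite index set; it is the maximum if `q ≥ 1`, and `0` if `q = 0`. -/
def fisherG {d : ℕ} (x : Fin d → ℝ) : ℝ :=
  (⨆ j : Fin (numFreq d), periodogram x ((j : ℕ) + 1)) /
    ∑ m ∈ Finset.Icc 1 (numFreq d), periodogram x m

open scoped Classical in
/-- The test statistic `f(x) = g(x) 𝟙{x ∉ A}`. -/
def fisherF {d : ℕ} (x : Fin d → ℝ) : ℝ :=
  fisherG x * (if x ∉ vanishingSet d then 1 else 0)

/-- `∑_{j=1}^q (-1)^{j+1} (q choose j) (1 - j k)_+^{q-1}`; the critical value `k_α` of the test is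
the solution `k` of `fisherTail q k = α`. -/
def fisherTail (q : ℕ) (k : ℝ) : ℝ :=
  ∑ j ∈ Finset.Icc 1 q,
    (-1 : ℝ) ^ (j + 1) * (q.choose j : ℝ) * (max (1 - (j : ℝ) * k) 0) ^ (q - 1)

end

/-! Since `d` is invertible modulo `r`, each progression `i, i + d, i + 2d, …` visits every residue
modulo `r` once per `r` steps (`sum_range_progression`). Hence all block means share the same
limiting mean `e` and the same limiting variance `v > 0`, and the periodic signal leaves no trace at
the Fourier frequencies.

The vector `e·1` lies in `A`, where Fisher's statistic has no continuity to offer, so a law of large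
numbers says nothing about `f(Z^n)`. What helps is invariance: the trigonometric vectors at
frequencies `1, …, q` are orthogonal to constants, so `g` is unchanged by `x ↦ a(x - c·1)` with `a ≠
0` (`fisherG_smul_sub_const`). One may therefore replace `Z^n` by `√m (Z^n - e·1)` with `m = ⌊n/d⌋`.
By a central limit theorem proved with characteristic functions
(`tendstoInDistribution_normalizedBlock`) this tends to `√v (N_1, …, N_d)`, and `√v` drops out by
the same invariance. For `q > 0` the limit almost surely avoids `A`, and `g` is continuous off `A`,
so the mapping theorem gives the limit law.

For the power, the periodogram ordinates of Gaussian noise are independent standard exponentials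
(`map_periodogram_noise`). Inclusion-exclusion together with a sum-preserving linear change of
variables gives Fisher's tail formula (`pi_stdExp_real_exists_exceed`). The tail is continuous in
the level, so the limit law has no atoms and the rejection probabilities converge. -/

/-! ### The periodogram -/

/-- Sums of the `d`-th roots of unity. -/
lemma sum_exp_fourier {d : ℕ} (hd : 0 < d) (m : ℤ) :
    ∑ l : Fin d, Complex.exp (((((l : ℕ) + 1 : ℕ) : ℝ) * (2 * Real.pi * m / d) : ℝ) * Complex.I)
      = if (d : ℤ) ∣ m then (d : ℂ) else 0 := by
  have hd' : (d : ℂ) ≠ 0 := by exact_mod_cast hd.ne'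
  set z : ℂ := Complex.exp (2 * Real.pi * m / d * Complex.I) with hz
  have hterm : ∀ l : ℕ,
      Complex.exp ((((l + 1 : ℕ) : ℝ) * (2 * Real.pi * m / d) : ℝ) * Complex.I) = z * z ^ l := by
    intro l
    rw [hz, ← pow_succ', ← Complex.exp_nat_mul]
    congr 1
    push_cast
    ring
  have hzd : z ^ d = 1 := by
    rw [hz, ← Complex.exp_nat_mul, Complex.exp_eq_one_iff]
    exact ⟨m, by field_simp⟩
  simp_rw [hterm]
  rw [← Finset.mul_sum, Fin.sum_univ_eq_sum_range (fun l => z ^ l) d]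
  split_ifs with h
  · obtain ⟨k, rfl⟩ := h
    have : z = 1 := by
      rw [hz, Complex.exp_eq_one_iff]
      refine ⟨k, ?_⟩
      push_cast
      field_simp
    simp [this]
  · have hz1 : z ≠ 1 := by
      intro h1
      rw [hz, Complex.exp_eq_one_iff] at h1
      obtain ⟨k, hk⟩ := h1
      apply h
      refine ⟨k, ?_⟩
      have h2 : (2 * Real.pi * Complex.I : ℂ) ≠ 0 := by simp [Real.pi_ne_zero]
      have h3 : (2 * Real.pi * Complex.I : ℂ) * m = (2 * Real.pi * Complex.I : ℂ) * (d * k) := by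
        field_simp at hk
        linear_combination (2 * Real.pi * Complex.I : ℂ) * hk
      have := mul_left_cancel₀ h2 h3
      exact_mod_cast this
    rw [geom_sum_eq hz1, hzd]
    simp

lemma sum_cos_fourier {d : ℕ} (hd : 0 < d) (m : ℤ) :
    ∑ l : Fin d, Real.cos ((((l : ℕ) + 1 : ℕ) : ℝ) * (2 * Real.pi * m / d))
      = if (d : ℤ) ∣ m then (d : ℝ) else 0 := by
  have h := congrArg Complex.re (sum_exp_fourier hd m)
  rw [Complex.re_sum] at h
  simp_rw [Complex.exp_ofReal_mul_I_re] at h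
  rw [h]
  split_ifs <;> simp

lemma sum_sin_fourier {d : ℕ} (hd : 0 < d) (m : ℤ) :
    ∑ l : Fin d, Real.sin ((((l : ℕ) + 1 : ℕ) : ℝ) * (2 * Real.pi * m / d)) = 0 := by
  have h := congrArg Complex.im (sum_exp_fourier hd m)
  rw [Complex.im_sum] at h
  simp_rw [Complex.exp_ofReal_mul_I_im] at h
  rw [h]
  split_ifs <;> simp

/-- The cosine (`b = 0`) and sine (`b = 1`) vectors at the `j`-th Fourier frequency. -/
noncomputable def trigVec (d j : ℕ) (b : Fin 2) (l : Fin d) : ℝ :=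
  if b = 0 then Real.cos ((((l : ℕ) + 1 : ℕ) : ℝ) * fourierFreq d j)
  else Real.sin ((((l : ℕ) + 1 : ℕ) : ℝ) * fourierFreq d j)

lemma two_mul_lt_of_le_numFreq {d j : ℕ} (hj : 1 ≤ j) (hjq : j ≤ numFreq d) : 2 * j < d := by
  unfold numFreq at hjq
  omega

lemma sum_trigVec_eq_zero {d j : ℕ} (hj : 1 ≤ j) (hjq : j ≤ numFreq d) (b : Fin 2) :
    ∑ l : Fin d, trigVec d j b l = 0 := by
  have h2 := two_mul_lt_of_le_numFreq hj hjq
  have hd : 0 < d := by omega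
  unfold trigVec fourierFreq
  split_ifs
  · have h := sum_cos_fourier hd (j : ℤ)
    rw [if_neg (by intro hdvd; have := Int.le_of_dvd (by omega) hdvd; omega)] at h
    exact_mod_cast h
  · exact_mod_cast sum_sin_fourier hd (j : ℤ)

/-- The trigonometric vectors are orthogonal, with squared length `d / 2`. -/
lemma sum_trigVec_mul_trigVec {d j k : ℕ} (hj : 1 ≤ j) (hjq : j ≤ numFreq d) (hk : 1 ≤ k)
    (hkq : k ≤ numFreq d) (b c : Fin 2) :
    ∑ l : Fin d, trigVec d j b l * trigVec d k c l
      = if j = k ∧ b = c then (d : ℝ) / 2 else 0 := by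
  have h2 := two_mul_lt_of_le_numFreq hj hjq
  have h2' := two_mul_lt_of_le_numFreq hk hkq
  have hd : 0 < d := by omega
  -- Product-to-sum formulas reduce everything to frequencies `j + k` and `j - k`. As `2j, 2k < d`
  -- strictly, `d` never divides `j + k`, and it divides `j - k` only if `j = k`.
  have hcp := sum_cos_fourier hd ((j : ℤ) + k)
  have hcm := sum_cos_fourier hd ((j : ℤ) - k)
  have hsp := sum_sin_fourier hd ((j : ℤ) + k)
  have hsm := sum_sin_fourier hd ((j : ℤ) - k)
  rw [if_neg (by intro hdvd; have := Int.le_of_dvd (by omega) hdvd; omega)] at hcp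
  have hiff : (d : ℤ) ∣ (j : ℤ) - k ↔ j = k := by
    constructor
    · intro hdvd
      have := Int.eq_zero_of_abs_lt_dvd hdvd (by rw [abs_lt]; omega)
      omega
    · rintro rfl; simp
  simp only [hiff] at hcm
  have hp : ∀ l : ℕ, (l : ℝ) * (2 * Real.pi * (((j : ℤ) + k : ℤ) : ℝ) / d)
      = (l : ℝ) * fourierFreq d j + (l : ℝ) * fourierFreq d k := by
    intro l; unfold fourierFreq; push_cast; ring
  have hm : ∀ l : ℕ, (l : ℝ) * (2 * Real.pi * (((j : ℤ) - k : ℤ) : ℝ) / d)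
      = (l : ℝ) * fourierFreq d j - (l : ℝ) * fourierFreq d k := by
    intro l; unfold fourierFreq; push_cast; ring
  simp only [hp, Real.cos_add, Real.sin_add, Finset.sum_add_distrib,
    Finset.sum_sub_distrib] at hcp hsp
  simp only [hm, Real.cos_sub, Real.sin_sub, Finset.sum_add_distrib,
    Finset.sum_sub_distrib] at hcm hsm
  fin_cases b <;> fin_cases c <;> simp only [trigVec] <;> by_cases hjk : j = k <;>
    simp [hjk] at hcm hcp hsp hsm ⊢ <;> linarith

/-- In real coordinates the periodogram is a sum of squares of two linear forms, which is the form
suited to both affine invariance and Gaussian vectors. -/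
lemma periodogram_eq {d : ℕ} (x : Fin d → ℝ) (j : ℕ) :
    periodogram x j = (1 / (d : ℝ)) *
      ((∑ l, trigVec d j 0 l * x l) ^ 2 + (∑ l, trigVec d j 1 l * x l) ^ 2) := by
  unfold periodogram
  congr 1
  rw [← Complex.normSq_eq_norm_sq, Complex.normSq_apply]
  have h : ∀ l : Fin d, (x l : ℂ) * Complex.exp (-Complex.I * (((l : ℕ) + 1 : ℕ) : ℂ) *
      (fourierFreq d j : ℂ)) =
      ((trigVec d j 0 l * x l : ℝ) : ℂ) - ((trigVec d j 1 l * x l : ℝ) : ℂ) * Complex.I := by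
    intro l
    have : -Complex.I * (((l : ℕ) + 1 : ℕ) : ℂ) * (fourierFreq d j : ℂ)
        = ((-((((l : ℕ) + 1 : ℕ) : ℝ) * fourierFreq d j) : ℝ) : ℂ) * Complex.I := by
      push_cast; ring
    rw [this, Complex.exp_mul_I, ← Complex.ofReal_cos, ← Complex.ofReal_sin, Real.cos_neg,
      Real.sin_neg]
    simp only [trigVec, if_true, one_ne_zero, if_false]
    push_cast
    ring
  simp_rw [h]
  rw [Complex.re_sum, Complex.im_sum]
  simp only [Complex.sub_re, Complex.sub_im, Complex.ofReal_re, Complex.ofReal_im,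
    Complex.re_ofReal_mul, Complex.im_ofReal_mul, Complex.I_re, Complex.I_im, mul_zero, mul_one,
    sub_zero, zero_sub, Finset.sum_neg_distrib]
  ring

lemma periodogram_nonneg {d : ℕ} (x : Fin d → ℝ) (j : ℕ) : 0 ≤ periodogram x j := by
  unfold periodogram; positivity

lemma continuous_periodogram {d : ℕ} (j : ℕ) :
    Continuous fun x : Fin d → ℝ => periodogram x j := by
  unfold periodogram; fun_prop

/-- Centring is invisible because the trigonometric vectors sum to zero; scaling passes through the
square. -/
lemma periodogram_smul_sub_const {d : ℕ} (x : Fin d → ℝ) (a c : ℝ) {j : ℕ} (hj : 1 ≤ j)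
    (hjq : j ≤ numFreq d) :
    periodogram (fun i => a * (x i - c)) j = a ^ 2 * periodogram x j := by
  have h : ∀ b, ∑ l, trigVec d j b l * (a * (x l - c)) = a * ∑ l, trigVec d j b l * x l := by
    intro b
    calc ∑ l, trigVec d j b l * (a * (x l - c))
        = a * ∑ l, trigVec d j b l * x l - a * c * ∑ l, trigVec d j b l := by
          rw [Finset.mul_sum, Finset.mul_sum, ← Finset.sum_sub_distrib]
          exact Finset.sum_congr rfl fun l _ => by ring
      _ = _ := by rw [sum_trigVec_eq_zero hj hjq]; ring
  rw [periodogram_eq, periodogram_eq, h, h]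
  ring

lemma const_mem_vanishingSet (d : ℕ) (c : ℝ) : (fun _ : Fin d => c) ∈ vanishingSet d := by
  intro j hj
  rw [Finset.mem_Icc] at hj
  have h := periodogram_smul_sub_const (fun _ : Fin d => c) 0 (-c) hj.1 hj.2
  -- The constant vector `c` is the zero vector shifted by `-c`.
  have h' := periodogram_smul_sub_const (fun _ : Fin d => (0 : ℝ)) 1 (-c) hj.1 hj.2
  simp only [zero_sub, neg_neg, one_mul, one_pow] at h'
  rw [h']
  simp [periodogram]

/-! ### Fisher's statistic -/

lemma fisherG_eq_zero_of_mem {d : ℕ} {x : Fin d → ℝ} (hx : x ∈ vanishingSet d) :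
    fisherG x = 0 := by
  unfold fisherG
  rw [Finset.sum_eq_zero hx, div_zero]

/-- On `A` the denominator vanishes and division by zero returns `0`, so the indicator is redundant.
-/
lemma fisherF_eq_fisherG {d : ℕ} (x : Fin d → ℝ) : fisherF x = fisherG x := by
  unfold fisherF
  by_cases h : x ∈ vanishingSet d
  · simp [fisherG_eq_zero_of_mem h]
  · simp [h]

lemma sum_periodogram_eq {d : ℕ} (x : Fin d → ℝ) :
    ∑ m ∈ Finset.Icc 1 (numFreq d), periodogram x m
      = ∑ j : Fin (numFreq d), periodogram x ((j : ℕ) + 1) := by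
  rw [Fin.sum_univ_eq_sum_range (fun j => periodogram x (j + 1)) (numFreq d),
    Finset.range_eq_Ico, Finset.sum_Ico_add' (fun j => periodogram x j) 0 (numFreq d) 1]
  congr 1

lemma fisherG_smul_sub_const {d : ℕ} (x : Fin d → ℝ) {a : ℝ} (ha : a ≠ 0) (c : ℝ) :
    fisherG (fun i => a * (x i - c)) = fisherG x := by
  unfold fisherG
  simp_rw [sum_periodogram_eq]
  have h : ∀ j : Fin (numFreq d), periodogram (fun i => a * (x i - c)) ((j : ℕ) + 1)
      = a ^ 2 * periodogram x ((j : ℕ) + 1) := fun j =>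
    periodogram_smul_sub_const x a c (by omega) (by omega)
  simp_rw [h]
  rw [← Real.mul_iSup_of_nonneg (sq_nonneg a), ← Finset.mul_sum,
    mul_div_mul_left _ _ (pow_ne_zero 2 ha)]

lemma fisherG_eq_zero_of_numFreq_eq_zero {d : ℕ} (hq : numFreq d = 0) (x : Fin d → ℝ) :
    fisherG x = 0 := by
  unfold fisherG
  simp [hq]

lemma mem_vanishingSet_iff {d : ℕ} (x : Fin d → ℝ) :
    x ∈ vanishingSet d ↔ ∑ j : Fin (numFreq d), periodogram x ((j : ℕ) + 1) = 0 := by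
  rw [← sum_periodogram_eq, Finset.sum_eq_zero_iff_of_nonneg fun j _ => periodogram_nonneg x j]
  rfl

lemma continuous_iSup_periodogram {d : ℕ} :
    Continuous fun x : Fin d → ℝ => ⨆ j : Fin (numFreq d), periodogram x ((j : ℕ) + 1) := by
  rcases isEmpty_or_nonempty (Fin (numFreq d)) with h | h
  · simp only [Real.iSup_of_isEmpty]
    exact continuous_const
  · simp_rw [← Finset.sup'_univ_eq_ciSup]
    exact Continuous.finset_sup'_apply _ fun j _ => continuous_periodogram _

lemma measurable_fisherG {d : ℕ} : Measurable (fisherG : (Fin d → ℝ) → ℝ) := by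
  unfold fisherG
  exact continuous_iSup_periodogram.measurable.div
    (continuous_finsetSum _ fun j _ => continuous_periodogram _).measurable

lemma continuousAt_fisherG {d : ℕ} {x : Fin d → ℝ} (hx : x ∉ vanishingSet d) :
    ContinuousAt (fisherG : (Fin d → ℝ) → ℝ) x := by
  unfold fisherG
  refine continuous_iSup_periodogram.continuousAt.div
    (continuous_finsetSum _ fun j _ => continuous_periodogram _).continuousAt ?_
  rwa [sum_periodogram_eq, Ne, ← mem_vanishingSet_iff]

/-! ### Averages of periodic sequences -/

lemma periodic_sum_range_of_sum_eq_zero {b : ℕ → ℝ} {r : ℕ} (hb : Function.Periodic b r)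
    (h0 : ∑ k ∈ Finset.range r, b k = 0) :
    Function.Periodic (fun m => ∑ k ∈ Finset.range m, b k) r := by
  intro m
  dsimp only
  rw [add_comm m r, Finset.sum_range_add, h0, zero_add]
  exact Finset.sum_congr rfl fun k _ => by rw [add_comm]; exact hb k

/-- Partial sums of a periodic sequence stay within bounded distance of their linear growth. -/
lemma exists_abs_sum_range_sub_le {a : ℕ → ℝ} {r : ℕ} (hr : 0 < r) (ha : Function.Periodic a r) :
    ∃ C, ∀ m : ℕ,
      |∑ k ∈ Finset.range m, a k - m * ((1 / (r : ℝ)) * ∑ k ∈ Finset.range r, a k)| ≤ C := by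
  set e := (1 / (r : ℝ)) * ∑ k ∈ Finset.range r, a k with he
  have hr' : (r : ℝ) ≠ 0 := by exact_mod_cast hr.ne'
  have hper : Function.Periodic (fun k => a k - e) r := fun k => by simp only [ha k]
  have hS := periodic_sum_range_of_sum_eq_zero hper (by
    rw [Finset.sum_sub_distrib, Finset.sum_const, Finset.card_range, nsmul_eq_mul, he]
    field_simp
    ring)
  refine ⟨∑ k ∈ Finset.range r, |a k - e|, fun m => ?_⟩
  have h1 : ∑ k ∈ Finset.range m, a k - m * e = ∑ k ∈ Finset.range m, (a k - e) := by
    rw [Finset.sum_sub_distrib, Finset.sum_const, Finset.card_range, nsmul_eq_mul]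
  -- The centred partial sums are periodic in `m`, so only `m % r < r` terms have to be bounded.
  rw [h1, ← hS.map_mod_nat m]
  refine (Finset.abs_sum_le_sum_abs _ _).trans ?_
  exact Finset.sum_le_sum_of_subset_of_nonneg
    (Finset.range_subset_range.mpr (Nat.mod_lt m hr).le) fun _ _ _ => abs_nonneg _

/-- The error of the average is `O(1/m)`, hence negligible even after multiplication by `√m`. This
permits centring at the limiting mean instead of the exact one. -/
lemma tendsto_sqrt_mul_average_sub {a : ℕ → ℝ} {r : ℕ} (hr : 0 < r)
    (ha : Function.Periodic a r) :
    Tendsto (fun m : ℕ => √(m : ℝ) * ((1 / (m : ℝ)) * ∑ k ∈ Finset.range m, a k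
      - (1 / (r : ℝ)) * ∑ k ∈ Finset.range r, a k)) atTop (𝓝 0) := by
  obtain ⟨C, hC⟩ := exists_abs_sum_range_sub_le hr ha
  have hlim : Tendsto (fun m : ℕ => C * (√(m : ℝ))⁻¹) atTop (𝓝 0) := by
    have := (tendsto_inv_atTop_zero.comp
      (Real.tendsto_sqrt_atTop.comp tendsto_natCast_atTop_atTop)).const_mul C
    simpa using this
  refine squeeze_zero_norm' ?_ hlim
  filter_upwards [eventually_gt_atTop 0] with m hm
  have hm' : (0 : ℝ) < m := by exact_mod_cast hm
  have hs : 0 < √(m : ℝ) := Real.sqrt_pos.mpr hm'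
  set e := (1 / (r : ℝ)) * ∑ k ∈ Finset.range r, a k
  have : √(m : ℝ) * ((1 / (m : ℝ)) * ∑ k ∈ Finset.range m, a k - e)
      = (∑ k ∈ Finset.range m, a k - m * e) * (√(m : ℝ))⁻¹ := by
    field_simp
    rw [Real.sq_sqrt hm'.le]
  rw [this, norm_mul, Real.norm_eq_abs, Real.norm_of_nonneg (inv_nonneg.mpr hs.le)]
  exact mul_le_mul_of_nonneg_right (hC m) (inv_nonneg.mpr hs.le)

lemma tendsto_average_of_periodic {a : ℕ → ℝ} {r : ℕ} (hr : 0 < r)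
    (ha : Function.Periodic a r) :
    Tendsto (fun m : ℕ => (1 / (m : ℝ)) * ∑ k ∈ Finset.range m, a k) atTop
      (𝓝 ((1 / (r : ℝ)) * ∑ k ∈ Finset.range r, a k)) := by
  set e := (1 / (r : ℝ)) * ∑ k ∈ Finset.range r, a k
  have h := tendsto_sqrt_mul_average_sub hr ha
  rw [tendsto_iff_norm_sub_tendsto_zero]
  refine squeeze_zero' (Eventually.of_forall fun _ => norm_nonneg _) ?_
    (tendsto_zero_iff_norm_tendsto_zero.mp h)
  · filter_upwards [eventually_ge_atTop 1] with m hm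
    rw [norm_mul]
    refine le_mul_of_one_le_left (norm_nonneg _) ?_
    rw [Real.norm_of_nonneg (Real.sqrt_nonneg _)]
    exact Real.one_le_sqrt.mpr (by exact_mod_cast hm)

/-- A sum over an arithmetic progression of step coprime to the period is a sum over a period. -/
lemma sum_range_progression {a : ℕ → ℝ} {r d : ℕ} (hr : 0 < r) (ha : Function.Periodic a r)
    (hrd : Nat.Coprime r d) (i : ℕ) :
    ∑ k ∈ Finset.range r, a (i + k * d) = ∑ k ∈ Finset.range r, a k := by
  -- Coprimality enters here: `d` can be cancelled modulo `r`, so the progression permutes the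
  -- residues.
  have hinj : Set.InjOn (fun k => (i + k * d) % r) (Finset.range r : Set ℕ) := by
    intro k hk l hl h
    have h1 : k * d ≡ l * d [MOD r] := Nat.ModEq.add_left_cancel' i h
    have h2 : k ≡ l [MOD r] := Nat.ModEq.cancel_right_of_coprime hrd h1
    exact h2.eq_of_lt_of_lt (Finset.mem_range.mp hk) (Finset.mem_range.mp hl)
  have himg : (Finset.range r).image (fun k => (i + k * d) % r) = Finset.range r := by
    refine Finset.eq_of_subset_of_card_le ?_ ?_
    · intro x hx
      obtain ⟨k, -, rfl⟩ := Finset.mem_image.mp hx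
      exact Finset.mem_range.mpr (Nat.mod_lt _ hr)
    · rw [Finset.card_image_of_injOn hinj]
  calc ∑ k ∈ Finset.range r, a (i + k * d)
      = ∑ k ∈ Finset.range r, a ((i + k * d) % r) :=
        Finset.sum_congr rfl fun k _ => (ha.map_mod_nat _).symm
    _ = ∑ k ∈ (Finset.range r).image (fun k => (i + k * d) % r), a k :=
        (Finset.sum_image hinj).symm
    _ = _ := by rw [himg]

/-! ### Characteristic functions of centred Bernoulli variables -/

/-- The characteristic function of a centred Bernoulli variable with success probability `p`. -/
noncomputable def centredBernoulliChar (p s : ℝ) : ℂ :=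
  (1 - p : ℝ) * Complex.exp ((s * (0 - p) : ℝ) * Complex.I)
    + (p : ℝ) * Complex.exp ((s * (1 - p) : ℝ) * Complex.I)

lemma norm_centredBernoulliChar_le_one {p : ℝ} (hp : p ∈ Set.Icc (0 : ℝ) 1) (s : ℝ) :
    ‖centredBernoulliChar p s‖ ≤ 1 := by
  unfold centredBernoulliChar
  refine (norm_add_le _ _).trans ?_
  rw [norm_mul, norm_mul, Complex.norm_exp_ofReal_mul_I, Complex.norm_exp_ofReal_mul_I,
    Complex.norm_real, Complex.norm_real, Real.norm_of_nonneg hp.1,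
    Real.norm_of_nonneg (sub_nonneg.mpr hp.2)]
  linarith

lemma norm_exp_mul_I_sub_taylor_le {y : ℝ} (hy : |y| ≤ 1) :
    ‖Complex.exp (y * Complex.I) - (1 + y * Complex.I - (y : ℂ) ^ 2 / 2)‖ ≤ |y| ^ 3 := by
  have hn : ‖(y : ℂ) * Complex.I‖ = |y| := by simp
  have h := Complex.exp_bound (x := y * Complex.I) (by rwa [hn]) (n := 3) (by norm_num)
  rw [hn] at h
  have h1 : ∑ m ∈ Finset.range 3, ((y : ℂ) * Complex.I) ^ m / (m.factorial : ℂ)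
      = 1 + y * Complex.I - (y : ℂ) ^ 2 / 2 := by
    simp only [Finset.sum_range_succ, Finset.sum_range_zero, mul_pow]
    simp [Nat.factorial]
    ring
  rw [h1] at h
  -- The Taylor remainder carries the constant `4 / (3! · 3)`, which is at most `1`.
  refine h.trans (mul_le_of_le_one_right (by positivity) ?_)
  norm_num [Nat.factorial]

/-- Both functions equal `1 - p(1-p)s²/2` up to third order. One `|s|³` comes from the two Taylor
remainders, weighted by `1 - p` and `p`; the other from the Gaussian factor, whose remainder is at
most `s⁴`. -/
lemma norm_centredBernoulliChar_sub_exp_le {p s : ℝ} (hp : p ∈ Set.Icc (0 : ℝ) 1)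
    (hs : |s| ≤ 1) :
    ‖centredBernoulliChar p s - Complex.exp ((-(p * (1 - p) * s ^ 2 / 2) : ℝ))‖
      ≤ 2 * |s| ^ 3 := by
  obtain ⟨hp0, hp1⟩ := hp
  have key : ∀ c : ℝ, |c| ≤ 1 → ‖Complex.exp ((s * c : ℝ) * Complex.I)
      - (1 + (s * c : ℝ) * Complex.I - ((s * c : ℝ) : ℂ) ^ 2 / 2)‖ ≤ |s| ^ 3 := by
    intro c hc
    have h1 : |s * c| ≤ |s| := by
      rw [abs_mul]; exact mul_le_of_le_one_right (abs_nonneg _) hc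
    exact (norm_exp_mul_I_sub_taylor_le (h1.trans hs)).trans
      (pow_le_pow_left₀ (abs_nonneg _) h1 3)
  have hA := key (0 - p) (by rw [abs_le]; constructor <;> linarith)
  have hB := key (1 - p) (by rw [abs_le]; constructor <;> linarith)
  set y : ℝ := p * (1 - p) * s ^ 2 / 2 with hy
  have hs2 : s ^ 2 ≤ 1 := by rw [← sq_abs]; exact pow_le_one₀ (abs_nonneg _) hs
  have hpp : p * (1 - p) ≤ 1 := by nlinarith
  have hpp0 : 0 ≤ p * (1 - p) := mul_nonneg hp0 (by linarith)
  have hy0 : 0 ≤ y := by positivity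
  have hys : y ≤ s ^ 2 := by
    have : p * (1 - p) * s ^ 2 ≤ 1 * s ^ 2 := mul_le_mul_of_nonneg_right hpp (sq_nonneg _)
    rw [hy]; nlinarith [sq_nonneg s]
  have hC : ‖Complex.exp ((-y : ℝ)) - (1 - (y : ℂ))‖ ≤ |s| ^ 3 := by
    have h := Real.abs_exp_sub_one_sub_id_le (x := -y)
      (by rw [abs_neg, abs_of_nonneg hy0]; linarith)
    have h2 : Complex.exp ((-y : ℝ)) - (1 - (y : ℂ)) = ((Real.exp (-y) - 1 - (-y) : ℝ) : ℂ) := by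
      push_cast; ring
    rw [h2, Complex.norm_real, Real.norm_eq_abs]
    refine h.trans ?_
    calc (-y) ^ 2 = y ^ 2 := by ring
      _ ≤ (s ^ 2) ^ 2 := pow_le_pow_left₀ hy0 hys 2
      _ = |s| ^ 3 * |s| := by rw [← sq_abs s]; ring
      _ ≤ |s| ^ 3 := mul_le_of_le_one_right (by positivity) hs
  set EA := Complex.exp ((s * (0 - p) : ℝ) * Complex.I)
    - (1 + (s * (0 - p) : ℝ) * Complex.I - ((s * (0 - p) : ℝ) : ℂ) ^ 2 / 2) with hEA
  set EB := Complex.exp ((s * (1 - p) : ℝ) * Complex.I)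
    - (1 + (s * (1 - p) : ℝ) * Complex.I - ((s * (1 - p) : ℝ) : ℂ) ^ 2 / 2) with hEB
  set EC := Complex.exp ((-y : ℝ)) - (1 - (y : ℂ)) with hEC
  -- The first-order terms cancel since the mean is zero, and the second-order terms match since
  -- `(1-p)p² + p(1-p)² = p(1-p)`.
  have hdecomp : centredBernoulliChar p s - Complex.exp ((-y : ℝ))
      = (1 - p : ℝ) * EA + (p : ℝ) * EB - EC := by
    rw [hEA, hEB, hEC, hy, centredBernoulliChar]
    push_cast
    ring
  rw [hdecomp]
  have hA' : ‖((1 - p : ℝ) : ℂ) * EA‖ ≤ (1 - p) * |s| ^ 3 := by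
    rw [norm_mul, Complex.norm_real, Real.norm_of_nonneg (sub_nonneg.mpr hp1)]
    exact mul_le_mul_of_nonneg_left hA (sub_nonneg.mpr hp1)
  have hB' : ‖((p : ℝ) : ℂ) * EB‖ ≤ p * |s| ^ 3 := by
    rw [norm_mul, Complex.norm_real, Real.norm_of_nonneg hp0]
    exact mul_le_mul_of_nonneg_left hB hp0
  refine (norm_sub_le _ _).trans ((add_le_add (norm_add_le _ _) le_rfl).trans ?_)
  linarith

/-- Lindeberg's replacement: exchange one factor at a time, the remaining factors having norm at
most `1`. -/
lemma norm_prod_range_sub_prod_range_le {a b : ℕ → ℂ} (ha : ∀ k, ‖a k‖ ≤ 1)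
    (hb : ∀ k, ‖b k‖ ≤ 1) (m : ℕ) :
    ‖∏ k ∈ Finset.range m, a k - ∏ k ∈ Finset.range m, b k‖
      ≤ ∑ k ∈ Finset.range m, ‖a k - b k‖ := by
  induction m with
  | zero => simp
  | succ m ih =>
    rw [Finset.prod_range_succ, Finset.prod_range_succ, Finset.sum_range_succ]
    have h : (∏ k ∈ Finset.range m, a k) * a m - (∏ k ∈ Finset.range m, b k) * b m
        = (∏ k ∈ Finset.range m, a k - ∏ k ∈ Finset.range m, b k) * a m
          + (∏ k ∈ Finset.range m, b k) * (a m - b m) := by ring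
    rw [h]
    refine (norm_add_le _ _).trans (add_le_add ?_ ?_)
    · rw [norm_mul]
      exact (mul_le_of_le_one_right (norm_nonneg _) (ha m)).trans ih
    · rw [norm_mul, norm_prod]
      exact mul_le_of_le_one_left (norm_nonneg _)
        (Finset.prod_le_one (fun _ _ => norm_nonneg _) fun k _ => hb k)

/-- The central limit theorem for Bernoulli variables whose variances converge in mean, in terms
of characteristic functions. -/
lemma tendsto_prod_centredBernoulliChar {a : ℕ → ℝ} (ha : ∀ k, a k ∈ Set.Icc (0 : ℝ) 1) {v : ℝ}
    (hv : Tendsto (fun m : ℕ => (1 / (m : ℝ)) * ∑ k ∈ Finset.range m, a k * (1 - a k)) atTop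
      (𝓝 v)) (t : ℝ) :
    Tendsto (fun m : ℕ => ∏ k ∈ Finset.range m, centredBernoulliChar (a k) ((√(m : ℝ))⁻¹ * t))
      atTop (𝓝 (Complex.exp ((-(v * t ^ 2 / 2) : ℝ)))) := by
  have hs0 : Tendsto (fun m : ℕ => (√(m : ℝ))⁻¹) atTop (𝓝 0) :=
    tendsto_inv_atTop_zero.comp (Real.tendsto_sqrt_atTop.comp tendsto_natCast_atTop_atTop)
  have hmain : Tendsto (fun m : ℕ => ∏ k ∈ Finset.range m,
      Complex.exp ((-(a k * (1 - a k) * ((√(m : ℝ))⁻¹ * t) ^ 2 / 2) : ℝ))) atTop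
      (𝓝 (Complex.exp ((-(v * t ^ 2 / 2) : ℝ)))) := by
    have h1 : Tendsto (fun m : ℕ => Complex.exp ((-(((1 / (m : ℝ)) *
        ∑ k ∈ Finset.range m, a k * (1 - a k)) * t ^ 2 / 2) : ℝ))) atTop
        (𝓝 (Complex.exp ((-(v * t ^ 2 / 2) : ℝ)))) :=
      (Complex.continuous_exp.tendsto _).comp ((Complex.continuous_ofReal.tendsto _).comp
        (((hv.mul_const _).div_const _).neg))
    refine h1.congr fun m => ?_
    rw [← Complex.exp_sum, ← Complex.ofReal_sum]
    congr 2
    rw [Finset.sum_neg_distrib, ← Finset.sum_div, ← Finset.sum_mul, mul_pow, inv_pow,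
      Real.sq_sqrt (Nat.cast_nonneg m)]
    ring
  -- There are `m` replacements, each costing at most `2|t|³ m^(-3/2)`, for a total of `2|t|³ / √m`.
  have hdiff : Tendsto (fun m : ℕ => ∏ k ∈ Finset.range m,
      centredBernoulliChar (a k) ((√(m : ℝ))⁻¹ * t) - ∏ k ∈ Finset.range m,
      Complex.exp ((-(a k * (1 - a k) * ((√(m : ℝ))⁻¹ * t) ^ 2 / 2) : ℝ))) atTop (𝓝 0) := by
    have hlim : Tendsto (fun m : ℕ => 2 * |t| ^ 3 * (√(m : ℝ))⁻¹) atTop (𝓝 0) := by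
      simpa using hs0.const_mul (2 * |t| ^ 3)
    refine squeeze_zero_norm' ?_ hlim
    have hsmall : ∀ᶠ m : ℕ in atTop, |(√(m : ℝ))⁻¹ * t| ≤ 1 := by
      have : Tendsto (fun m : ℕ => |(√(m : ℝ))⁻¹ * t|) atTop (𝓝 0) := by
        simpa using (hs0.mul_const t).abs
      exact this.eventually (eventually_le_nhds zero_lt_one)
    filter_upwards [hsmall, eventually_gt_atTop 0] with m hm hm0
    refine (norm_prod_range_sub_prod_range_le
      (fun k => norm_centredBernoulliChar_le_one (ha k) _) (fun k => ?_) m).trans ?_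
    · rw [← Complex.ofReal_exp, Complex.norm_real, Real.norm_of_nonneg (Real.exp_pos _).le,
        Real.exp_le_one_iff]
      have := mul_nonneg (ha k).1 (sub_nonneg.mpr (ha k).2)
      have := mul_nonneg this (sq_nonneg ((√(m : ℝ))⁻¹ * t))
      linarith
    · refine (Finset.sum_le_sum fun k _ =>
        norm_centredBernoulliChar_sub_exp_le (ha k) hm).trans ?_
      rw [Finset.sum_const, Finset.card_range, nsmul_eq_mul, abs_mul, mul_pow,
        abs_of_nonneg (inv_nonneg.mpr (Real.sqrt_nonneg _))]
      have hmp : (0 : ℝ) < m := by exact_mod_cast hm0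
      have hsq : (0 : ℝ) < √(m : ℝ) := Real.sqrt_pos.mpr hmp
      have : (m : ℝ) = √(m : ℝ) ^ 2 := (Real.sq_sqrt hmp.le).symm
      apply le_of_eq
      nth_rewrite 1 [this]
      field_simp
  simpa using hdiff.add hmain

/-! ### Binary variables -/

section Binary

variable {Ω : Type*} [MeasurableSpace Ω] {μ : Measure Ω} {X : Ω → ℝ}

lemma integrable_of_binary [IsProbabilityMeasure μ] (hX : Measurable X)
    (hb : ∀ ω, X ω = 0 ∨ X ω = 1) :
    Integrable X μ :=
  Integrable.of_bound hX.aestronglyMeasurable 1 (Eventually.of_forall fun ω => by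
    rcases hb ω with h | h <;> simp [h])

lemma integral_of_binary (hX : Measurable X) (hb : ∀ ω, X ω = 0 ∨ X ω = 1) :
    ∫ ω, X ω ∂μ = μ.real {ω | X ω = 1} := by
  have hs : MeasurableSet {ω | X ω = 1} := hX (measurableSet_singleton 1)
  rw [← integral_indicator_one hs]
  refine integral_congr_ae (Eventually.of_forall fun ω => ?_)
  rcases hb ω with h | h <;> simp [Set.indicator, h]

lemma variance_of_binary [IsProbabilityMeasure μ] (hX : Measurable X)
    (hb : ∀ ω, X ω = 0 ∨ X ω = 1) :
    variance X μ = μ.real {ω | X ω = 1} * (1 - μ.real {ω | X ω = 1}) := by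
  have hL : MemLp X 2 μ := MemLp.of_bound hX.aestronglyMeasurable 1
    (Eventually.of_forall fun ω => by rcases hb ω with h | h <;> simp [h])
  have hsq : X ^ 2 = X := by
    ext ω
    rcases hb ω with h | h <;> simp [h]
  rw [variance_eq_sub hL, hsq, integral_of_binary hX hb]
  ring

lemma integral_comp_of_binary [IsProbabilityMeasure μ] (hX : Measurable X)
    (hb : ∀ ω, X ω = 0 ∨ X ω = 1) (F : ℝ → ℂ) :
    ∫ ω, F (X ω) ∂μ = ((1 - μ.real {ω | X ω = 1} : ℝ) : ℂ) * F 0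
      + (μ.real {ω | X ω = 1} : ℂ) * F 1 := by
  -- Every function on `{0, 1}` is affine, so only the mean of `X` matters.
  have h : ∀ ω, F (X ω) = F 0 + (X ω : ℂ) * (F 1 - F 0) := by
    intro ω
    rcases hb ω with h | h <;> simp [h]
  simp_rw [h]
  rw [integral_add (integrable_const _) ((integrable_of_binary hX hb).ofReal.mul_const _),
    integral_mul_const, integral_complex_ofReal, integral_of_binary hX hb]
  simp
  ring

end Binary

/-! ### Moments and characteristic functions of the block sums. -/

namespace IsPeriodicBinarySeries

variable {Ω : Type*} [MeasurableSpace Ω] {μ : Measure Ω} {Y : ℕ → Ω → ℝ} {p : ℕ → ℝ} {r : ℕ}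

lemma period_pos (hY : IsPeriodicBinarySeries μ Y p r) : 0 < r := hY.period.1.1

lemma periodic (hY : IsPeriodicBinarySeries μ Y p r) : Function.Periodic p r := fun l => by
  have := hY.period.1.2 l 1
  rwa [one_mul, add_comm] at this

lemma periodic_progression (hY : IsPeriodicBinarySeries μ Y p r) (d i : ℕ) :
    Function.Periodic (fun k => p (i + k * d)) r := fun k => by
  have h := hY.periodic.nat_mul d (i + k * d)
  simp only
  rw [← h]
  congr 1
  push_cast
  ring

lemma variance_eq [IsProbabilityMeasure μ] (hY : IsPeriodicBinarySeries μ Y p r) (l : ℕ) :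
    variance (Y l) μ = p l * (1 - p l) := by
  rw [variance_of_binary (hY.measurable l) (hY.binary l), ← hY.prob_eq l]

lemma limitMean_eq (hY : IsPeriodicBinarySeries μ Y p r) {d : ℕ} (hrd : Nat.Coprime r d)
    (i : Fin d) : limitMean p r d i = (1 / (r : ℝ)) * ∑ k ∈ Finset.range r, p k := by
  unfold limitMean
  rw [sum_range_progression hY.period_pos hY.periodic hrd]

lemma limitVariance_eq [IsProbabilityMeasure μ]
    (hY : IsPeriodicBinarySeries μ Y p r) {d : ℕ} (hrd : Nat.Coprime r d)
    (i : Fin d) :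
    limitVariance μ Y r d i = (1 / (r : ℝ)) * ∑ k ∈ Finset.range r, p k * (1 - p k) := by
  unfold limitVariance
  simp_rw [hY.variance_eq]
  rw [sum_range_progression (a := fun l => p l * (1 - p l)) hY.period_pos
    (fun l => by simp only [hY.periodic l]) hrd]

lemma average_variance_pos (hY : IsPeriodicBinarySeries μ Y p r) :
    0 < (1 / (r : ℝ)) * ∑ k ∈ Finset.range r, p k * (1 - p k) := by
  have hr : (0 : ℝ) < r := by exact_mod_cast hY.period_pos
  refine mul_pos (by positivity) (Finset.sum_pos (fun k _ => ?_) ?_)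
  · exact mul_pos (hY.prob_mem k).1 (sub_pos.mpr (hY.prob_mem k).2)
  · exact Finset.nonempty_range_iff.mpr hY.period_pos.ne'

lemma tendsto_average_variance (hY : IsPeriodicBinarySeries μ Y p r) {d : ℕ}
    (hrd : Nat.Coprime r d) (i : ℕ) :
    Tendsto (fun m : ℕ => (1 / (m : ℝ)) *
      ∑ k ∈ Finset.range m, p (i + k * d) * (1 - p (i + k * d))) atTop
      (𝓝 ((1 / (r : ℝ)) * ∑ k ∈ Finset.range r, p k * (1 - p k))) := by
  have h := tendsto_average_of_periodic (a := fun k => p (i + k * d) * (1 - p (i + k * d)))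
    hY.period_pos (fun k => by
      have := hY.periodic_progression d i k
      simp only at this ⊢
      rw [this])
  rwa [sum_range_progression (a := fun l => p l * (1 - p l)) hY.period_pos
    (fun l => by simp only [hY.periodic l]) hrd] at h

/-- Uniqueness of division with remainder by `d`: no observation is used twice, which is the source
of independence within and between the coordinates. -/
lemma progression_injective {d : ℕ} (hd : 0 < d) :
    Function.Injective fun ik : Fin d × ℕ => (ik.1 : ℕ) + ik.2 * d := by
  rintro ⟨i, k⟩ ⟨i', k'⟩ h
  simp only at h
  have hi : (i : ℕ) = i' := by
    have := congrArg (· % d) h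
    simpa [Nat.add_mul_mod_self_right, Nat.mod_eq_of_lt i.2, Nat.mod_eq_of_lt i'.2] using this
  rw [hi, Nat.add_left_cancel_iff] at h
  exact Prod.ext (Fin.ext hi) (Nat.eq_of_mul_eq_mul_right hd h)

/-- The variance of a normalized block sum is the average of the variances. -/
lemma variance_sqrt_mul_average [IsProbabilityMeasure μ]
    (hY : IsPeriodicBinarySeries μ Y p r) {d : ℕ} (i : Fin d)
    (m : ℕ) :
    variance (fun ω => √(m : ℝ) * ((1 / (m : ℝ)) * ∑ k ∈ Finset.range m, Y (i + k * d) ω)) μ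
      = (1 / (m : ℝ)) * ∑ k ∈ Finset.range m, p (i + k * d) * (1 - p (i + k * d)) := by
  have hd : 0 < d := i.pos
  rw [variance_const_mul, variance_const_mul, ← Finset.sum_fn, IndepFun.variance_sum, ← mul_assoc]
  · simp_rw [hY.variance_eq]
    congr 1
    rw [Real.sq_sqrt (Nat.cast_nonneg m)]
    rcases eq_or_ne (m : ℝ) 0 with h | h
    · simp [h]
    · field_simp
  · intro k _
    exact MemLp.of_bound (hY.measurable _).aestronglyMeasurable 1
      (Eventually.of_forall fun ω => by
        rcases hY.binary (i + k * d) ω with h | h <;> simp [h])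
  · intro k _ l _ hkl
    refine hY.indep.indepFun fun h => hkl ?_
    exact congrArg Prod.snd (progression_injective hd (a₁ := (i, k)) (a₂ := (i, l)) h)

/-- The normalized block sums. -/
noncomputable def normalizedBlock (Y : ℕ → Ω → ℝ) (d : ℕ) (e : ℝ) (m : ℕ) (ω : Ω) :
    EuclideanSpace ℝ (Fin d) :=
  WithLp.toLp 2 fun i =>
    √(m : ℝ) * ((1 / (m : ℝ)) * ∑ k ∈ Finset.range m, Y (i + k * d) ω - e)

lemma measurable_normalizedBlock (hY : IsPeriodicBinarySeries μ Y p r) (d : ℕ) (e : ℝ) (m : ℕ) :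
    Measurable (normalizedBlock Y d e m) := by
  unfold normalizedBlock
  have := hY.measurable
  fun_prop

/-- Each coordinate splits into a deterministic bias, due to centring at `e`, and a sum of
independent centred Bernoulli variables. -/
lemma charFun_normalizedBlock [IsProbabilityMeasure μ]
    (hY : IsPeriodicBinarySeries μ Y p r) {d : ℕ} (hd : 0 < d) (e : ℝ)
    {m : ℕ} (hm : 0 < m) (t : EuclideanSpace ℝ (Fin d)) :
    charFun (μ.map (normalizedBlock Y d e m)) t = ∏ i : Fin d,
      (Complex.exp ((t i * (√(m : ℝ) * ((1 / (m : ℝ)) * ∑ k ∈ Finset.range m, p (i + k * d) - e))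
        : ℝ) * Complex.I)
      * ∏ k ∈ Finset.range m, centredBernoulliChar (p (i + k * d)) ((√(m : ℝ))⁻¹ * t i)) := by
  have hmp : (0 : ℝ) < m := by exact_mod_cast hm
  have hs : (0 : ℝ) < √(m : ℝ) := Real.sqrt_pos.mpr hmp
  set b : Fin d → ℝ := fun i =>
    √(m : ℝ) * ((1 / (m : ℝ)) * ∑ k ∈ Finset.range m, p (i + k * d) - e) with hb
  rw [charFun_apply, integral_map (hY.measurable_normalizedBlock d e m).aemeasurable
    (by fun_prop)]
  have hexp : ∀ ω, Complex.exp ((inner ℝ (normalizedBlock Y d e m ω) t : ℝ) * Complex.I)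
      = (∏ i : Fin d, Complex.exp ((t i * b i : ℝ) * Complex.I)) *
        ∏ ik : Fin d × Fin m, Complex.exp ((((√(m : ℝ))⁻¹ * t ik.1) *
          (Y (ik.1 + ik.2 * d) ω - p (ik.1 + ik.2 * d)) : ℝ) * Complex.I) := by
    intro ω
    rw [← Complex.exp_sum, ← Complex.exp_sum, ← Complex.exp_add, ← Finset.sum_mul,
      ← Finset.sum_mul, ← add_mul, ← Complex.ofReal_sum, ← Complex.ofReal_sum,
      ← Complex.ofReal_add]
    congr 3
    rw [Fintype.sum_prod_type, ← Finset.sum_add_distrib, PiLp.inner_apply]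
    refine Finset.sum_congr rfl fun i _ => ?_
    dsimp only
    rw [← Finset.mul_sum, Finset.sum_sub_distrib,
      Fin.sum_univ_eq_sum_range (fun k => Y (i + k * d) ω),
      Fin.sum_univ_eq_sum_range (fun k => p (i + k * d))]
    simp only [normalizedBlock, hb, RCLike.inner_apply, conj_trivial]
    have : (√(m : ℝ))⁻¹ = √(m : ℝ) * (1 / (m : ℝ)) := by
      field_simp
      rw [Real.sq_sqrt hmp.le]
    rw [this]
    ring
  simp_rw [hexp]
  rw [integral_const_mul]
  have hind : iIndepFun (fun ik : Fin d × Fin m => Y ((ik.1 : ℕ) + ik.2 * d)) μ := by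
    refine hY.indep.precomp (g := fun ik : Fin d × Fin m => (ik.1 : ℕ) + ik.2 * d) ?_
    intro x y hxy
    have := progression_injective hd (a₁ := (x.1, (x.2 : ℕ))) (a₂ := (y.1, (y.2 : ℕ))) hxy
    simp only [Prod.mk.injEq] at this
    exact Prod.ext this.1 (Fin.ext this.2)
  rw [hind.integral_fun_prod_comp (fun ik => (hY.measurable _).aemeasurable)
    (f := fun ik y => Complex.exp ((((√(m : ℝ))⁻¹ * t ik.1) *
          (y - p (ik.1 + ik.2 * d)) : ℝ) * Complex.I))
    (fun ik => by fun_prop)]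
  have hint : ∀ ik : Fin d × Fin m, ∫ ω, Complex.exp ((((√(m : ℝ))⁻¹ * t ik.1) *
      (Y (ik.1 + ik.2 * d) ω - p (ik.1 + ik.2 * d)) : ℝ) * Complex.I) ∂μ
      = centredBernoulliChar (p (ik.1 + ik.2 * d)) ((√(m : ℝ))⁻¹ * t ik.1) := by
    intro ik
    rw [integral_comp_of_binary (hY.measurable _) (hY.binary _) (fun y =>
      Complex.exp ((((√(m : ℝ))⁻¹ * t ik.1) * (y - p (ik.1 + ik.2 * d)) : ℝ) * Complex.I)),
      ← hY.prob_eq]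
    rfl
  simp_rw [hint]
  rw [Fintype.prod_prod_type, Finset.prod_mul_distrib]
  congr 1
  refine Finset.prod_congr rfl fun i _ => ?_
  exact Fin.prod_univ_eq_prod_range
    (fun k => centredBernoulliChar (p (i + k * d)) ((√(m : ℝ))⁻¹ * t i)) m

end IsPeriodicBinarySeries

/-! ### The Gaussian limit and the central limit theorem. -/

section Gaussian

variable {Ω' : Type*} [MeasurableSpace Ω'] {ν : Measure Ω'}

lemma charFun_scaled_standard_normal {ι : Type*} [Fintype ι] {N : ι → Ω' → ℝ}
    (hN : iIndepFun N ν) (hN' : ∀ i, HasLaw (N i) (gaussianReal 0 1) ν) (c : ℝ)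
    (t : EuclideanSpace ℝ ι) :
    charFun (ν.map fun ω => (WithLp.toLp 2 fun i => c * N i ω : EuclideanSpace ℝ ι)) t
      = ∏ i, Complex.exp ((-(c ^ 2 * t i ^ 2 / 2) : ℝ)) := by
  have hm : ∀ i, AEMeasurable (N i) ν := fun i => (hN' i).aemeasurable
  have hX : AEMeasurable (fun ω => (WithLp.toLp 2 fun i => c * N i ω : EuclideanSpace ℝ ι)) ν :=
    (PiLp.continuous_toLp 2 fun _ : ι => ℝ).measurable.comp_aemeasurable
      (aemeasurable_pi_lambda _ fun i => (hm i).const_mul c)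
  rw [charFun_apply, integral_map hX (by fun_prop)]
  have hexp : ∀ ω, Complex.exp ((inner ℝ
      (WithLp.toLp 2 fun i => c * N i ω : EuclideanSpace ℝ ι) t : ℝ) * Complex.I)
      = ∏ i, Complex.exp (((c * t i : ℝ) : ℂ) * (N i ω : ℂ) * Complex.I) := by
    intro ω
    rw [← Complex.exp_sum, ← Finset.sum_mul, PiLp.inner_apply, Complex.ofReal_sum]
    congr 2
    refine Finset.sum_congr rfl fun i _ => ?_
    simp only [RCLike.inner_apply, conj_trivial]
    push_cast
    ring
  simp_rw [hexp]
  rw [hN.integral_fun_prod_comp (𝕜 := ℂ) hm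
    (f := fun i (y : ℝ) => Complex.exp (((c * t i : ℝ) : ℂ) * (y : ℂ) * Complex.I))
    (fun i => by fun_prop)]
  refine Finset.prod_congr rfl fun i _ => ?_
  have h := charFun_gaussianReal (μ := 0) (v := 1) (c * t i)
  rw [charFun_apply_real, ← (hN' i).map_eq, integral_map (hm i) (by fun_prop)] at h
  rw [h]
  congr 1
  push_cast
  ring

end Gaussian

/-- The multivariate central limit theorem for the block means. -/
lemma IsPeriodicBinarySeries.tendstoInDistribution_normalizedBlock
    {Ω : Type*} [MeasurableSpace Ω] {μ : Measure Ω} [IsProbabilityMeasure μ]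
    {Y : ℕ → Ω → ℝ} {p : ℕ → ℝ} {r d : ℕ}
    (hY : IsPeriodicBinarySeries μ Y p r) (hd : 0 < d) (hrd : Nat.Coprime r d)
    {Ω' : Type*} [MeasurableSpace Ω'] {ν : Measure Ω'} [IsProbabilityMeasure ν]
    {N : Fin d → Ω' → ℝ} (hN : iIndepFun N ν) (hN' : ∀ i, HasLaw (N i) (gaussianReal 0 1) ν) :
    TendstoInDistribution
      (normalizedBlock Y d ((1 / (r : ℝ)) * ∑ k ∈ Finset.range r, p k)) atTop
      (fun ω => WithLp.toLp 2 fun i =>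
        √((1 / (r : ℝ)) * ∑ k ∈ Finset.range r, p k * (1 - p k)) * N i ω) (fun _ => μ) ν where
  forall_aemeasurable m := (hY.measurable_normalizedBlock d _ m).aemeasurable
  aemeasurable_limit := (PiLp.continuous_toLp 2 fun _ : Fin d => ℝ).measurable.comp_aemeasurable
      (aemeasurable_pi_lambda _ fun i => (hN' i).aemeasurable.const_mul _)
  tendsto := by
    refine ProbabilityMeasure.tendsto_of_tendsto_charFun fun t => ?_
    simp only [ProbabilityMeasure.coe_mk]
    rw [charFun_scaled_standard_normal hN hN',
      Real.sq_sqrt hY.average_variance_pos.le]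
    have h : Tendsto (fun m : ℕ => ∏ i : Fin d,
        (Complex.exp ((t i * (√(m : ℝ) * ((1 / (m : ℝ)) * ∑ k ∈ Finset.range m, p (i + k * d)
          - (1 / (r : ℝ)) * ∑ k ∈ Finset.range r, p k)) : ℝ) * Complex.I)
        * ∏ k ∈ Finset.range m, centredBernoulliChar (p (i + k * d)) ((√(m : ℝ))⁻¹ * t i)))
        atTop (𝓝 (∏ i : Fin d, (Complex.exp ((t i * 0 : ℝ) * Complex.I) * Complex.exp
          ((-(((1 / (r : ℝ)) * ∑ k ∈ Finset.range r, p k * (1 - p k)) * t i ^ 2 / 2) : ℝ))))) := by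
      refine tendsto_finsetProd _ fun i _ => Tendsto.mul ?_ ?_
      · have h1 := tendsto_sqrt_mul_average_sub hY.period_pos (hY.periodic_progression d i)
        rw [sum_range_progression hY.period_pos hY.periodic hrd] at h1
        exact (Complex.continuous_exp.tendsto _).comp
          (((Complex.continuous_ofReal.tendsto _).comp (h1.const_mul (t i))).mul_const _)
      · exact tendsto_prod_centredBernoulliChar
          (fun k => ⟨(hY.prob_mem _).1.le, (hY.prob_mem _).2.le⟩)
          (hY.tendsto_average_variance hrd i) (t i)
    simp only [mul_zero, Complex.ofReal_zero, zero_mul, Complex.exp_zero, one_mul] at h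
    refine h.congr' ?_
    filter_upwards [eventually_gt_atTop 0] with m hm
    exact (hY.charFun_normalizedBlock hd _ hm t).symm

/-! ### Fisher's formula for independent exponential variables -/

/-- The standard exponential distribution. -/
noncomputable def stdExp : Measure ℝ :=
  (volume.restrict (Set.Ioi 0)).withDensity fun x => ENNReal.ofReal (Real.exp (-x))

lemma stdExp_apply {s : Set ℝ} (hs : MeasurableSet s) :
    stdExp s = ENNReal.ofReal (∫ x in s ∩ Set.Ioi 0, Real.exp (-x)) := by
  rw [stdExp, withDensity_apply _ hs, Measure.restrict_restrict hs,
    ofReal_integral_eq_lintegral_ofReal]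
  · exact (integrableOn_exp_neg_Ioi 0).mono_set Set.inter_subset_right
  · exact Eventually.of_forall fun x => (Real.exp_pos _).le

instance : IsProbabilityMeasure stdExp where
  measure_univ := by
    rw [stdExp_apply MeasurableSet.univ, Set.univ_inter, integral_exp_neg_Ioi_zero,
      ENNReal.ofReal_one]

/-- The positive orthant. -/
def posOrthant (q : ℕ) : Set (Fin q → ℝ) := Set.univ.pi fun _ => Set.Ioi 0

lemma measurableSet_posOrthant (q : ℕ) : MeasurableSet (posOrthant q) :=
  MeasurableSet.univ_pi fun _ => measurableSet_Ioi

lemma mem_posOrthant {q : ℕ} {x : Fin q → ℝ} : x ∈ posOrthant q ↔ ∀ i, 0 < x i := by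
  simp [posOrthant]

/-- The product density depends on the coordinates only through their sum, so linear maps preserving
the sum leave it unchanged. -/
lemma pi_stdExp (q : ℕ) :
    Measure.pi (fun _ : Fin q => stdExp) = (volume.restrict (posOrthant q)).withDensity
      fun x => ENNReal.ofReal (Real.exp (-∑ i, x i)) := by
  refine Measure.pi_eq fun s hs => ?_
  have hA : ∀ i, Integrable (fun x => Real.exp (-x)) (volume.restrict (s i ∩ Set.Ioi 0)) :=
    fun i => (integrableOn_exp_neg_Ioi 0).mono_set Set.inter_subset_right
  rw [withDensity_apply _ (MeasurableSet.univ_pi hs),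
    Measure.restrict_restrict (MeasurableSet.univ_pi hs), posOrthant, ← Set.pi_inter_distrib,
    volume_pi, Measure.restrict_pi_pi]
  simp_rw [← Finset.sum_neg_distrib, Real.exp_sum]
  rw [← ofReal_integral_eq_lintegral_ofReal (Integrable.fintype_prod hA)
      (Eventually.of_forall fun x => Finset.prod_nonneg fun i _ => (Real.exp_pos _).le),
    integral_fintype_prod_eq_prod (fun _ x => Real.exp (-x)),
    ENNReal.ofReal_prod_of_nonneg fun i _ => integral_nonneg fun x => (Real.exp_pos _).le]
  exact Finset.prod_congr rfl fun i _ => (stdExp_apply (hs i)).symm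

lemma pi_stdExp_apply {q : ℕ} {B : Set (Fin q → ℝ)} (hB : MeasurableSet B) :
    Measure.pi (fun _ : Fin q => stdExp) B
      = ∫⁻ x in B ∩ posOrthant q, ENNReal.ofReal (Real.exp (-∑ i, x i)) := by
  rw [pi_stdExp, withDensity_apply _ hB, Measure.restrict_restrict hB]

/-- The event that all coordinates in `J` exceed the fraction `k` of the total. -/
def exceedSet {q : ℕ} (J : Finset (Fin q)) (k : ℝ) : Set (Fin q → ℝ) :=
  {x | ∀ i ∈ J, k * ∑ l, x l < x i}

lemma exceedSet_eq_iInter {q : ℕ} (J : Finset (Fin q)) (k : ℝ) :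
    exceedSet J k = ⋂ i ∈ J, {x : Fin q → ℝ | k * ∑ l, x l < x i} := by
  ext x; simp [exceedSet]

lemma measurableSet_exceed {q : ℕ} (i : Fin q) (k : ℝ) :
    MeasurableSet {x : Fin q → ℝ | k * ∑ l, x l < x i} :=
  measurableSet_lt (by fun_prop) (by fun_prop)

lemma measurableSet_exceedSet {q : ℕ} (J : Finset (Fin q)) (k : ℝ) :
    MeasurableSet (exceedSet J k) := by
  rw [exceedSet_eq_iInter]
  exact Finset.measurableSet_biInter J fun i _ => measurableSet_exceed i k

/-- The matrix of the map `x ↦ (x - k (∑ x) 1_J) / (1 - |J| k)`, which preserves coordinate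
sums. -/
noncomputable def exceedMatrix {q : ℕ} (J : Finset (Fin q)) (k : ℝ) : Matrix (Fin q) (Fin q) ℝ :=
  (1 - J.card * k)⁻¹ • (1 + Matrix.replicateCol Unit (fun i => if i ∈ J then -k else 0) *
    Matrix.replicateRow Unit fun _ : Fin q => (1 : ℝ))

lemma exceedMatrix_mulVec {q : ℕ} (J : Finset (Fin q)) (k : ℝ) (x : Fin q → ℝ) (i : Fin q) :
    Matrix.toLin' (exceedMatrix J k) x i
      = (1 - J.card * k)⁻¹ * (x i - if i ∈ J then k * ∑ l, x l else 0) := by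
  rw [Matrix.toLin'_apply, exceedMatrix, Matrix.smul_mulVec, Pi.smul_apply, smul_eq_mul,
    Matrix.add_mulVec, Matrix.one_mulVec, Pi.add_apply]
  congr 1
  rw [sub_eq_add_neg]
  congr 1
  simp only [Matrix.mulVec, dotProduct, Matrix.mul_apply, Matrix.replicateCol_apply,
    Matrix.replicateRow_apply, Finset.univ_unique, Finset.sum_singleton, mul_one,
    ← Finset.mul_sum]
  split_ifs <;> simp

lemma sum_exceedMatrix_mulVec {q : ℕ} {J : Finset (Fin q)} {k : ℝ} (hJ : J.card * k < 1)
    (x : Fin q → ℝ) : ∑ i, Matrix.toLin' (exceedMatrix J k) x i = ∑ i, x i := by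
  simp_rw [exceedMatrix_mulVec]
  rw [← Finset.mul_sum, Finset.sum_sub_distrib, Finset.sum_ite_mem, Finset.univ_inter,
    Finset.sum_const, nsmul_eq_mul]
  have : (1 - J.card * k) ≠ 0 := by linarith
  field_simp

/-- The rank-one update of the identity has determinant `1 - |J|k`, which cancels one of the `q`
inverse factors contributed by the scalar. -/
lemma det_exceedMatrix {q : ℕ} {J : Finset (Fin q)} {k : ℝ} (hq : 0 < q)
    (hJ : J.card * k < 1) :
    (exceedMatrix J k).det = ((1 - J.card * k) ^ (q - 1))⁻¹ := by
  have hc : (1 - J.card * k) ≠ 0 := by linarith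
  rw [exceedMatrix, Matrix.det_smul, Matrix.det_one_add_replicateCol_mul_replicateRow,
    Fintype.card_fin]
  have : (1 : ℝ) + (fun _ => 1) ⬝ᵥ (fun i : Fin q => if i ∈ J then -k else 0)
      = 1 - J.card * k := by
    simp [dotProduct, Finset.sum_ite_mem]
    ring
  rw [this]
  obtain ⟨n, rfl⟩ : ∃ n, q = n + 1 := ⟨q - 1, by omega⟩
  rw [Nat.add_sub_cancel, pow_succ, mul_assoc, inv_mul_cancel₀ hc, mul_one, inv_pow]

lemma exceedSet_inter_posOrthant {q : ℕ} {J : Finset (Fin q)} {k : ℝ} (hq : 0 < q) (hk : 0 ≤ k)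
    (hJ : J.card * k < 1) :
    exceedSet J k ∩ posOrthant q = Matrix.toLin' (exceedMatrix J k) ⁻¹' posOrthant q := by
  have hc : 0 < (1 - J.card * k)⁻¹ := inv_pos.mpr (by linarith)
  have : Nonempty (Fin q) := ⟨⟨0, hq⟩⟩
  ext x
  simp only [Set.mem_inter_iff, Set.mem_preimage, mem_posOrthant, exceedMatrix_mulVec,
    mul_pos_iff_of_pos_left hc, sub_pos]
  constructor
  · rintro ⟨h1, h2⟩ i
    split_ifs with hi
    exacts [h1 i hi, h2 i]
  · intro h
    -- The image has positive coordinates and the same sum. With `k ≥ 0`, the coordinates in `J`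
    -- then exceed `k ∑ x ≥ 0` and are positive too.
    have hS : 0 < ∑ i, x i := by
      rw [← sum_exceedMatrix_mulVec hJ]
      refine Finset.sum_pos (fun i _ => ?_) Finset.univ_nonempty
      rw [exceedMatrix_mulVec]
      exact mul_pos hc (sub_pos.mpr (h i))
    refine ⟨fun i hi => by simpa [hi] using h i, fun i => ?_⟩
    have := h i
    split_ifs at this with hi
    · exact (mul_nonneg hk hS.le).trans_lt this
    · exact this

/-- Within the orthant the event is the preimage of the whole orthant under a linear map that
preserves the density. Its probability is thus the inverse of the determinant. -/
lemma pi_stdExp_exceedSet_of_lt {q : ℕ} {J : Finset (Fin q)} {k : ℝ} (hq : 0 < q) (hk : 0 ≤ k)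
    (hJ : J.card * k < 1) :
    Measure.pi (fun _ : Fin q => stdExp) (exceedSet J k)
      = ENNReal.ofReal ((1 - J.card * k) ^ (q - 1)) := by
  have hc : 0 < (1 - J.card * k) := by linarith
  have hdet : (exceedMatrix J k).det ≠ 0 := by
    rw [det_exceedMatrix hq hJ]; positivity
  have hTm : Measurable (Matrix.toLin' (exceedMatrix J k)) :=
    (Matrix.toLin' (exceedMatrix J k)).continuous_of_finiteDimensional.measurable
  have hone : ∫⁻ x in posOrthant q, ENNReal.ofReal (Real.exp (-∑ i, x i)) = 1 := by
    have := pi_stdExp_apply (q := q) MeasurableSet.univ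
    rwa [measure_univ, Set.univ_inter, eq_comm] at this
  rw [pi_stdExp_apply (measurableSet_exceedSet J k), exceedSet_inter_posOrthant hq hk hJ]
  calc ∫⁻ x in Matrix.toLin' (exceedMatrix J k) ⁻¹' posOrthant q,
        ENNReal.ofReal (Real.exp (-∑ i, x i))
      = ∫⁻ x in Matrix.toLin' (exceedMatrix J k) ⁻¹' posOrthant q,
        ENNReal.ofReal (Real.exp (-∑ i, Matrix.toLin' (exceedMatrix J k) x i)) := by
        simp_rw [sum_exceedMatrix_mulVec hJ]
    _ = ∫⁻ y in posOrthant q, ENNReal.ofReal (Real.exp (-∑ i, y i))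
        ∂(Measure.map (Matrix.toLin' (exceedMatrix J k)) volume) :=
        (setLIntegral_map (measurableSet_posOrthant q)
          (f := fun y : Fin q → ℝ => ENNReal.ofReal (Real.exp (-∑ i, y i)))
          (by fun_prop) hTm).symm
    _ = ENNReal.ofReal ((1 - J.card * k) ^ (q - 1)) := by
        rw [Real.map_matrix_volume_pi_eq_smul_volume_pi hdet, Measure.restrict_smul,
          lintegral_smul_measure, hone, det_exceedMatrix hq hJ, inv_inv,
          abs_of_pos (pow_pos hc _), smul_eq_mul, mul_one]

/-- The shares of the coordinates in `J` would add up to more than `|J|k ≥ 1`. -/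
lemma pi_stdExp_exceedSet_of_le {q : ℕ} {J : Finset (Fin q)} {k : ℝ} (hJn : J.Nonempty)
    (hJ : 1 ≤ J.card * k) :
    Measure.pi (fun _ : Fin q => stdExp) (exceedSet J k) = 0 := by
  have hempty : exceedSet J k ∩ posOrthant q = ∅ := by
    rw [Set.eq_empty_iff_forall_notMem]
    rintro x ⟨h1, h2⟩
    rw [mem_posOrthant] at h2
    have hS : 0 ≤ ∑ i, x i := Finset.sum_nonneg fun i _ => (h2 i).le
    have h3 : ∑ i ∈ J, k * ∑ l, x l < ∑ i ∈ J, x i := Finset.sum_lt_sum_of_nonempty hJn h1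
    rw [Finset.sum_const, nsmul_eq_mul, ← mul_assoc] at h3
    have h4 : ∑ i ∈ J, x i ≤ ∑ i, x i :=
      Finset.sum_le_sum_of_subset_of_nonneg (Finset.subset_univ _) fun i _ _ => (h2 i).le
    nlinarith
  rw [pi_stdExp_apply (measurableSet_exceedSet J k), hempty, Measure.restrict_empty,
    lintegral_zero_measure]

lemma pi_stdExp_real_exceedSet {q : ℕ} {J : Finset (Fin q)} {k : ℝ} (hq : 2 ≤ q) (hk : 0 ≤ k)
    (hJn : J.Nonempty) :
    (Measure.pi (fun _ : Fin q => stdExp)).real (exceedSet J k)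
      = (max (1 - J.card * k) 0) ^ (q - 1) := by
  rcases lt_or_ge ((J.card : ℝ) * k) 1 with h | h
  · rw [Measure.real, pi_stdExp_exceedSet_of_lt (by omega) hk h, max_eq_left (by linarith),
      ENNReal.toReal_ofReal (pow_nonneg (by linarith) _)]
  · rw [Measure.real, pi_stdExp_exceedSet_of_le hJn h, max_eq_right (by linarith),
      -- Here `q ≥ 2` matters: for `q = 1` the power would be `0^0 = 1`.
      zero_pow (by omega), ENNReal.toReal_zero]

/-- Fisher's formula for the largest share of independent exponential variables. -/
lemma pi_stdExp_real_exists_exceed {q : ℕ} {k : ℝ} (hq : 2 ≤ q) (hk : 0 ≤ k) :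
    (Measure.pi (fun _ : Fin q => stdExp)).real {x | ∃ i, k * ∑ l, x l < x i}
      = fisherTail q k := by
  have hU : {x : Fin q → ℝ | ∃ i, k * ∑ l, x l < x i}
      = ⋃ i ∈ (Finset.univ : Finset (Fin q)), {x | k * ∑ l, x l < x i} := by
    ext x; simp
  -- Inclusion-exclusion; the terms depend only on `|J|`, and grouping by cardinality produces the
  -- binomial coefficients.
  rw [hU, measureReal_biUnion_eq_sum_powerset fun i _ => measurableSet_exceed i k]
  simp_rw [← exceedSet_eq_iInter]
  have h1 : ∀ J ∈ (Finset.univ : Finset (Fin q)).powerset.filter (·.Nonempty),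
      (-1 : ℝ) ^ (J.card + 1) * (Measure.pi (fun _ : Fin q => stdExp)).real (exceedSet J k)
      = (-1 : ℝ) ^ (J.card + 1) * (max (1 - J.card * k) 0) ^ (q - 1) := by
    intro J hJ
    rw [pi_stdExp_real_exceedSet hq hk (Finset.mem_filter.mp hJ).2]
  rw [Finset.sum_congr rfl h1, Finset.sum_filter]
  have h2 : ∀ J ∈ (Finset.univ : Finset (Fin q)).powerset,
      (if J.Nonempty then (-1 : ℝ) ^ (J.card + 1) * (max (1 - J.card * k) 0) ^ (q - 1) else 0)
      = (fun j : ℕ => if 1 ≤ j then (-1 : ℝ) ^ (j + 1) * (max (1 - j * k) 0) ^ (q - 1) else 0)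
        J.card := by
    intro J _
    simp only [← Finset.card_pos, Nat.succ_le_iff]
  rw [Finset.sum_congr rfl h2, Finset.sum_powerset_apply_card
    (fun j : ℕ => if 1 ≤ j then (-1 : ℝ) ^ (j + 1) * (max (1 - j * k) 0) ^ (q - 1) else 0),
    Finset.card_univ, Fintype.card_fin, fisherTail]
  rw [← Finset.sum_subset (s₁ := Finset.Icc 1 q)]
  · refine Finset.sum_congr rfl fun j hj => ?_
    rw [if_pos (Finset.mem_Icc.mp hj).1, nsmul_eq_mul]
    ring
  · intro j hj
    rw [Finset.mem_Icc] at hj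
    exact Finset.mem_range.mpr (by omega)
  · intro j hj hj'
    rw [Finset.mem_range] at hj
    rw [Finset.mem_Icc] at hj'
    rw [if_neg (by omega), smul_zero]

lemma continuous_fisherTail (q : ℕ) : Continuous (fisherTail q) := by
  unfold fisherTail
  fun_prop

/-- The positive parts are inactive, so the sum is, up to sign, a `q`-th finite difference of a
polynomial of degree below `q`, without its `j = 0` term. The full difference vanishes, and the
missing term accounts for the `1`. -/
lemma fisherTail_eq_one_of_nonpos {q : ℕ} (hq : 0 < q) {k : ℝ} (hk : k ≤ 0) :
    fisherTail q k = 1 := by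
  set P : Polynomial ℝ := (1 - Polynomial.C k * Polynomial.X) ^ (q - 1) with hP
  have hdeg : P.natDegree < q := by
    have h1 : (1 - Polynomial.C k * Polynomial.X : Polynomial ℝ).natDegree ≤ 1 := by
      compute_degree
    have h2 : P.natDegree ≤ (q - 1) * 1 := Polynomial.natDegree_pow_le_of_le _ h1
    omega
  have h := congrFun (Polynomial.fwdDiff_iter_eq_zero_of_degree_lt hdeg) 0
  rw [fwdDiff_iter_eq_sum_shift] at h
  set a : ℕ → ℝ := fun j => (-1 : ℝ) ^ (j + 1) * (q.choose j : ℝ) *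
    (max (1 - (j : ℝ) * k) 0) ^ (q - 1) with ha
  have hterm : ∀ j ∈ Finset.range (q + 1),
      ((-1 : ℤ) ^ (q - j) * q.choose j) • P.eval ((0 : ℝ) + j • (1 : ℝ))
        = (-1 : ℝ) ^ (q + 1) * a j := by
    intro j hj
    have hjq : j ≤ q := by rw [Finset.mem_range] at hj; omega
    have h0 : 0 ≤ 1 - (j : ℝ) * k := by
      have := mul_nonneg (Nat.cast_nonneg (α := ℝ) j) (neg_nonneg.mpr hk)
      linarith
    have hsign : (-1 : ℝ) ^ (q - j) = (-1) ^ (q + 1) * (-1) ^ (j + 1) := by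
      rw [← pow_add]
      obtain ⟨n, rfl⟩ := Nat.exists_eq_add_of_le hjq
      rw [Nat.add_sub_cancel_left, show j + n + 1 + (j + 1) = n + 2 * (j + 1) by ring, pow_add,
        pow_mul]
      simp
    have heval : P.eval ((0 : ℝ) + j • (1 : ℝ)) = (1 - (j : ℝ) * k) ^ (q - 1) := by
      rw [hP, Polynomial.eval_pow, Polynomial.eval_sub, Polynomial.eval_one, Polynomial.eval_mul,
        Polynomial.eval_C, Polynomial.eval_X, zero_add, nsmul_eq_mul, mul_one, mul_comm k]
    rw [heval, zsmul_eq_mul, ha]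
    simp only [max_eq_left h0]
    push_cast
    rw [hsign]
    ring
  rw [Finset.sum_congr rfl hterm, ← Finset.mul_sum, Pi.zero_apply, mul_eq_zero,
    or_iff_right (pow_ne_zero _ (by norm_num)), Finset.sum_range_eq_add_Ico _ (Nat.succ_pos q)] at h
  have h0 : a 0 = -1 := by simp [ha]
  have hfT : fisherTail q k = ∑ j ∈ Finset.Ico 1 (q + 1), a j := rfl
  rw [hfT]
  linarith

/-! ### The periodogram of Gaussian white noise -/

/-- The squared radius of a planar Gaussian vector is exponentially distributed. -/
lemma map_gaussianReal_prod_sq_add_sq {v : NNReal} (hv : v ≠ 0) :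
    ((gaussianReal 0 v).prod (gaussianReal 0 v)).map
      (fun z : ℝ × ℝ => (z.1 ^ 2 + z.2 ^ 2) / (2 * v)) = stdExp := by
  have hv0 : (0 : ℝ) < v := by exact_mod_cast pos_iff_ne_zero.mpr hv
  have hm : Measurable fun z : ℝ × ℝ => (z.1 ^ 2 + z.2 ^ 2) / (2 * (v : ℝ)) := by fun_prop
  ext s hs
  rw [Measure.map_apply hm hs, gaussianReal_of_var_ne_zero 0 hv,
    prod_withDensity (by fun_prop) (by fun_prop), ← Measure.volume_eq_prod,
    withDensity_apply _ (hm hs), ← lintegral_indicator (hm hs),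
    ← lintegral_comp_polarCoord_symm]
  set g : ℝ → ENNReal := fun u => s.indicator (fun u => ENNReal.ofReal (Real.exp (-u))) u with hg
  have hgm : Measurable g := by
    exact Measurable.indicator (by fun_prop) hs
  -- In polar coordinates the integrand is independent of the angle. The factor `ρ / v` is the
  -- derivative of `ρ² / (2v)`, which prepares the substitution `u = ρ² / (2v)`.
  have hint : ∀ z ∈ polarCoord.target, ENNReal.ofReal z.1 •
      ((fun z : ℝ × ℝ => (z.1 ^ 2 + z.2 ^ 2) / (2 * (v : ℝ))) ⁻¹' s).indicator
        (fun z => gaussianPDF 0 v z.1 * gaussianPDF 0 v z.2) (polarCoord.symm z)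
      = ENNReal.ofReal (1 / (2 * Real.pi)) *
        (ENNReal.ofReal |z.1 / v| * g (z.1 ^ 2 / (2 * v))) := by
    rintro ⟨ρ, θ⟩ hz
    have hρ : 0 < ρ := hz.1
    have hsq : (ρ * Real.cos θ) ^ 2 + (ρ * Real.sin θ) ^ 2 = ρ ^ 2 := by
      rw [mul_pow, mul_pow, ← mul_add, Real.cos_sq_add_sin_sq, mul_one]
    have hmem : polarCoord.symm (ρ, θ) ∈
        (fun z : ℝ × ℝ => (z.1 ^ 2 + z.2 ^ 2) / (2 * (v : ℝ))) ⁻¹' s ↔ ρ ^ 2 / (2 * v) ∈ s := by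
      rw [Set.mem_preimage, polarCoord_symm_apply, hsq]
    simp only [hg]
    by_cases h : ρ ^ 2 / (2 * v) ∈ s
    · rw [Set.indicator_of_mem (hmem.mpr h), Set.indicator_of_mem h, polarCoord_symm_apply,
        smul_eq_mul, gaussianPDF, gaussianPDF, ← ENNReal.ofReal_mul (gaussianPDFReal_nonneg _ _ _),
        ← ENNReal.ofReal_mul hρ.le, ← ENNReal.ofReal_mul (abs_nonneg _),
        ← ENNReal.ofReal_mul (by positivity)]
      congr 1
      rw [abs_of_pos (by positivity)]
      simp only [gaussianPDFReal, sub_zero]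
      have hexp : Real.exp (-(ρ ^ 2 / (2 * v)))
          = Real.exp (-(ρ * Real.cos θ) ^ 2 / (2 * v))
            * Real.exp (-(ρ * Real.sin θ) ^ 2 / (2 * v)) := by
        rw [← Real.exp_add]
        congr 1
        rw [← hsq]
        ring
      have hsqrt : √(2 * Real.pi * v) * √(2 * Real.pi * v) = 2 * Real.pi * v :=
        Real.mul_self_sqrt (by positivity)
      rw [hexp]
      have hinv : (√(2 * Real.pi * v))⁻¹ * (√(2 * Real.pi * v))⁻¹ = (2 * Real.pi * v)⁻¹ := by
        rw [← mul_inv, hsqrt]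
      calc _ = ρ * ((√(2 * Real.pi * v))⁻¹ * (√(2 * Real.pi * v))⁻¹) *
            (Real.exp (-(ρ * Real.cos θ) ^ 2 / (2 * v))
            * Real.exp (-(ρ * Real.sin θ) ^ 2 / (2 * v))) := by ring
        _ = _ := by rw [hinv]; field_simp
    · rw [Set.indicator_of_notMem (mt hmem.mp h), Set.indicator_of_notMem h]
      simp
  rw [setLIntegral_congr_fun polarCoord.open_target.measurableSet hint]
  have htarget : polarCoord.target = Set.Ioi (0 : ℝ) ×ˢ Set.Ioo (-Real.pi) Real.pi := rfl
  have hF : Measurable fun ρ : ℝ => ENNReal.ofReal |ρ / v| * g (ρ ^ 2 / (2 * v)) :=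
    (by fun_prop : Measurable fun ρ : ℝ => ENNReal.ofReal |ρ / v|).mul (hgm.comp (by fun_prop))
  have hF' : Measurable fun z : ℝ × ℝ => ENNReal.ofReal |z.1 / v| * g (z.1 ^ 2 / (2 * v)) :=
    hF.comp measurable_fst
  rw [lintegral_const_mul _ hF', htarget, Measure.volume_eq_prod,
    ← Measure.prod_restrict, lintegral_prod _ hF'.aemeasurable]
  simp only [lintegral_const, Measure.restrict_apply MeasurableSet.univ, Set.univ_inter,
    Real.volume_Ioo]
  rw [lintegral_mul_const _ hF, mul_comm, mul_assoc,
    ← ENNReal.ofReal_mul (by linarith [Real.pi_pos])]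
  have hone : ENNReal.ofReal ((Real.pi - -Real.pi) * (1 / (2 * Real.pi))) = 1 := by
    rw [← ENNReal.ofReal_one]
    congr 1
    field_simp
    ring
  rw [hone, mul_one]
  have hderiv : ∀ ρ ∈ Set.Ioi (0 : ℝ),
      HasDerivWithinAt (fun ρ : ℝ => ρ ^ 2 / (2 * v)) (ρ / v) (Set.Ioi 0) ρ := by
    intro ρ _
    have := ((hasDerivAt_pow 2 ρ).div_const (2 * (v : ℝ))).hasDerivWithinAt (s := Set.Ioi 0)
    have heq : ((2 : ℕ) : ℝ) * ρ ^ (2 - 1) / (2 * v) = ρ / v := by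
      field_simp
      simp
    rwa [heq] at this
  have hinj : Set.InjOn (fun ρ : ℝ => ρ ^ 2 / (2 * v)) (Set.Ioi 0) := by
    intro a ha b hb hab
    simp only at hab
    rw [div_left_inj' (by positivity)] at hab
    exact (pow_left_inj₀ (le_of_lt ha) (le_of_lt hb) two_ne_zero).mp hab
  have himg : (fun ρ : ℝ => ρ ^ 2 / (2 * v)) '' Set.Ioi 0 = Set.Ioi 0 := by
    ext u
    constructor
    · rintro ⟨ρ, hρ, rfl⟩
      have : 0 < ρ := hρ
      exact Set.mem_Ioi.mpr (by positivity)
    · intro hu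
      have hu : 0 < u := hu
      refine ⟨√(2 * v * u), Set.mem_Ioi.mpr (Real.sqrt_pos.mpr (by positivity)), ?_⟩
      simp only
      rw [Real.sq_sqrt (by positivity)]
      field_simp
  rw [← lintegral_image_eq_lintegral_abs_deriv_mul measurableSet_Ioi hderiv hinj g, himg, stdExp,
    withDensity_apply _ hs, hg, lintegral_indicator hs]

section WhiteNoise

variable {Ω' : Type*} [MeasurableSpace Ω'] {ν : Measure Ω'} {d : ℕ} {N : Fin d → Ω' → ℝ}

/-- The Fourier coefficients of the noise vector. -/
noncomputable def noiseCoeff (N : Fin d → Ω' → ℝ) (j : Fin (numFreq d)) (b : Fin 2) (ω : Ω') : ℝ :=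
  ∑ l, trigVec d (j + 1) b l * N l ω

/-- A linear image of a Gaussian vector. Joint Gaussianity is what later lets vanishing covariances
imply independence. -/
lemma hasGaussianLaw_noiseCoeff (hN : iIndepFun N ν)
    (hN' : ∀ i, HasLaw (N i) (gaussianReal 0 1) ν) :
    HasGaussianLaw (fun ω j b => noiseCoeff N j b ω) ν := by
  have h := hN.hasGaussianLaw fun i => (hN' i).hasGaussianLaw
  have h' := h.map_fun (ContinuousLinearMap.pi fun j : Fin (numFreq d) =>
    ContinuousLinearMap.pi fun b : Fin 2 =>
      ∑ l, trigVec d (j + 1) b l • ContinuousLinearMap.proj (R := ℝ) (φ := fun _ : Fin d => ℝ) l)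
  have heq : (fun ω j b => noiseCoeff N j b ω) = fun ω =>
      (ContinuousLinearMap.pi fun j : Fin (numFreq d) => ContinuousLinearMap.pi fun b : Fin 2 =>
        ∑ l, trigVec d (j + 1) b l •
          ContinuousLinearMap.proj (R := ℝ) (φ := fun _ : Fin d => ℝ) l) fun i => N i ω := by
    ext ω j b
    simp [noiseCoeff]
  rwa [heq]

/-- For white noise, covariances of linear forms are inner products of their coefficient vectors, so
orthogonality of the trigonometric vectors decides. -/
lemma covariance_noiseCoeff (hN : iIndepFun N ν)
    (hN' : ∀ i, HasLaw (N i) (gaussianReal 0 1) ν) (j k : Fin (numFreq d)) (b c : Fin 2) :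
    cov[noiseCoeff N j b, noiseCoeff N k c; ν] = if j = k ∧ b = c then (d : ℝ) / 2 else 0 := by
  have := hN.isProbabilityMeasure
  have hL : ∀ i, MemLp (N i) 2 ν := fun i => (hN' i).hasGaussianLaw.memLp_two
  have hcov : ∀ l l', cov[N l, N l'; ν] = if l = l' then 1 else 0 := by
    intro l l'
    split_ifs with h
    · subst h
      rw [covariance_self (hL l).aemeasurable, (hN' l).variance_eq, variance_id_gaussianReal]
      simp
    · exact (hN.indepFun h).covariance_eq_zero (hL l) (hL l')
  unfold noiseCoeff
  rw [covariance_fun_sum_fun_sum (fun l => (hL l).const_mul _) (fun l => (hL l).const_mul _)]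
  simp_rw [covariance_const_mul_left, covariance_const_mul_right, hcov]
  simp only [mul_ite, mul_one, mul_zero, Finset.sum_ite_eq, Finset.mem_univ, if_true]
  rw [sum_trigVec_mul_trigVec (by omega) (by omega) (by omega) (by omega)]
  simp [Fin.ext_iff]

lemma integral_noiseCoeff (hN' : ∀ i, HasLaw (N i) (gaussianReal 0 1) ν) (j : Fin (numFreq d))
    (b : Fin 2) : ∫ ω, noiseCoeff N j b ω ∂ν = 0 := by
  unfold noiseCoeff
  rw [integral_finsetSum _ fun l _ => (hN' l).hasGaussianLaw.integrable.const_mul _]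
  refine Finset.sum_eq_zero fun l _ => ?_
  rw [integral_const_mul, (hN' l).integral_eq, integral_id_gaussianReal, mul_zero]

lemma map_noiseCoeff (hN : iIndepFun N ν) (hN' : ∀ i, HasLaw (N i) (gaussianReal 0 1) ν)
    (j : Fin (numFreq d)) (b : Fin 2) :
    ν.map (noiseCoeff N j b) = gaussianReal 0 ((d : ℝ) / 2).toNNReal := by
  have h : HasGaussianLaw (noiseCoeff N j b) ν :=
    ((hasGaussianLaw_noiseCoeff hN hN').eval j).eval b
  rw [h.map_eq_gaussianReal, integral_noiseCoeff hN', ← covariance_self h.aemeasurable,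
    covariance_noiseCoeff hN hN', if_pos ⟨rfl, rfl⟩]

/-- The periodogram ordinates of Gaussian white noise are independent standard exponentials. -/
lemma map_periodogram_noise (hN : iIndepFun N ν)
    (hN' : ∀ i, HasLaw (N i) (gaussianReal 0 1) ν) :
    ν.map (fun ω (j : Fin (numFreq d)) => periodogram (fun i => N i ω) ((j : ℕ) + 1))
      = Measure.pi fun _ => stdExp := by
  have := hN.isProbabilityMeasure
  have hG := hasGaussianLaw_noiseCoeff hN hN'
  have hind : iIndepFun (fun j ω b => noiseCoeff N j b ω) ν := by
    refine hG.iIndepFun_of_covariance_eval fun j k hjk b c => ?_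
    rw [covariance_noiseCoeff hN hN', if_neg fun h => hjk h.1]
  have hP : ∀ j : Fin (numFreq d), (fun ω => periodogram (fun i => N i ω) ((j : ℕ) + 1))
      = (fun u : Fin 2 → ℝ => (1 / (d : ℝ)) * (u 0 ^ 2 + u 1 ^ 2)) ∘
        fun ω b => noiseCoeff N j b ω := by
    intro j
    ext ω
    simp only [periodogram_eq, Function.comp, noiseCoeff]
  have hmeas : Measurable fun u : Fin 2 → ℝ => (1 / (d : ℝ)) * (u 0 ^ 2 + u 1 ^ 2) := by fun_prop
  have hind' : iIndepFun
      (fun (j : Fin (numFreq d)) ω => periodogram (fun i => N i ω) ((j : ℕ) + 1)) ν := by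
    have hP' : (fun (j : Fin (numFreq d)) ω => periodogram (fun i => N i ω) ((j : ℕ) + 1))
        = fun j => (fun u : Fin 2 → ℝ => (1 / (d : ℝ)) * (u 0 ^ 2 + u 1 ^ 2)) ∘
          fun ω b => noiseCoeff N j b ω := funext hP
    rw [hP']
    exact hind.comp _ fun _ => hmeas
  have hNm : AEMeasurable (fun ω i => N i ω) ν :=
    aemeasurable_pi_lambda _ fun i => (hN' i).aemeasurable
  have hPm : ∀ j : Fin (numFreq d),
      AEMeasurable (fun ω => periodogram (fun i => N i ω) ((j : ℕ) + 1)) ν := fun j =>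
    (continuous_periodogram _).measurable.comp_aemeasurable hNm
  rw [iIndepFun.map_fun_eq_pi_map hPm hind']
  congr 1
  ext1 j
  have hd : 0 < d := by
    have := two_mul_lt_of_le_numFreq (d := d) (j := j + 1) (by omega) (by omega)
    omega
  have hd' : (0 : ℝ) < d := by exact_mod_cast hd
  have hb : ∀ b, HasGaussianLaw (noiseCoeff N j b) ν := fun b => (hG.eval j).eval b
  have hpair : HasGaussianLaw (fun ω => (noiseCoeff N j 0 ω, noiseCoeff N j 1 ω)) ν :=
    (hG.eval j).map_fun ((ContinuousLinearMap.proj (R := ℝ) (φ := fun _ : Fin 2 => ℝ) 0).prod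
      (ContinuousLinearMap.proj (R := ℝ) (φ := fun _ : Fin 2 => ℝ) 1))
  have hindep : IndepFun (noiseCoeff N j 0) (noiseCoeff N j 1) ν := by
    refine hpair.indepFun_of_covariance_eq_zero ?_
    rw [covariance_noiseCoeff hN hN', if_neg (by simp)]
  have hprod := (indepFun_iff_map_prod_eq_prod_map_map (hb 0).aemeasurable
    (hb 1).aemeasurable).mp hindep
  rw [map_noiseCoeff hN hN', map_noiseCoeff hN hN'] at hprod
  have hv : ((d : ℝ) / 2).toNNReal ≠ 0 := by
    rw [Ne, Real.toNNReal_eq_zero, not_le]; positivity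
  -- The variance `v = d / 2` gives `2v = d`, the normalization of the periodogram.
  rw [← map_gaussianReal_prod_sq_add_sq hv, ← hprod,
    AEMeasurable.map_map_of_aemeasurable (by fun_prop) hpair.aemeasurable]
  congr 1
  ext ω
  simp only [periodogram_eq, Function.comp, noiseCoeff, Real.coe_toNNReal _ (half_pos hd').le]
  field_simp

end WhiteNoise

/-! ### The mapping theorem -/

/-- The mapping theorem for maps that are continuous at almost every point of the limit law. -/
lemma TendstoInDistribution.comp_of_ae_continuousAt {ι E F : Type*} {Ω : ι → Type*}
    {Ω' : Type*} {mΩ : ∀ i, MeasurableSpace (Ω i)} {mΩ' : MeasurableSpace Ω'}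
    {μ : ∀ i, Measure (Ω i)} [∀ i, IsProbabilityMeasure (μ i)] {μ' : Measure Ω'}
    [IsProbabilityMeasure μ'] [TopologicalSpace E] [MeasurableSpace E] [OpensMeasurableSpace E]
    [HasOuterApproxClosed E] [TopologicalSpace F] [MeasurableSpace F] [OpensMeasurableSpace F]
    [HasOuterApproxClosed F]
    {X : (i : ι) → Ω i → E} {Z : Ω' → E} {l : Filter ι} [l.IsCountablyGenerated]
    (h : TendstoInDistribution X l Z μ μ') {g : E → F} (hg : Measurable g)
    (hcont : ∀ᵐ ω ∂μ', ContinuousAt g (Z ω)) :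
    TendstoInDistribution (fun i ω => g (X i ω)) l (fun ω => g (Z ω)) μ μ' where
  forall_aemeasurable i := hg.comp_aemeasurable (h.forall_aemeasurable i)
  aemeasurable_limit := hg.comp_aemeasurable h.aemeasurable_limit
  tendsto := by
    have hgX : ∀ i, AEMeasurable (fun ω => g (X i ω)) (μ i) := fun i =>
      hg.comp_aemeasurable (h.forall_aemeasurable i)
    have hgZ : AEMeasurable (fun ω => g (Z ω)) μ' := hg.comp_aemeasurable h.aemeasurable_limit
    refine tendsto_of_forall_isClosed_limsup_le' fun C hC => ?_
    simp only [ProbabilityMeasure.coe_mk]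
    have h1 := ProbabilityMeasure.limsup_measure_closed_le_of_tendsto h.tendsto
      (isClosed_closure (s := g ⁻¹' C))
    simp only [ProbabilityMeasure.coe_mk] at h1
    refine le_trans (limsup_le_limsup (Eventually.of_forall fun i => ?_)) (h1.trans ?_)
    · dsimp only
      rw [Measure.map_apply_of_aemeasurable (hgX i) hC.measurableSet,
        Measure.map_apply_of_aemeasurable (h.forall_aemeasurable i)
          isClosed_closure.measurableSet]
      exact measure_mono fun ω hω => subset_closure hω
    · rw [Measure.map_apply_of_aemeasurable hgZ hC.measurableSet,
        Measure.map_apply_of_aemeasurable h.aemeasurable_limit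
          isClosed_closure.measurableSet]
      refine measure_mono_ae ?_
      -- At a continuity point of `g` in the closure of `g ⁻¹' C`, the value of `g` lies in the
      -- closed set `C`.
      filter_upwards [hcont] with ω hω hmem
      have := mem_closure_image hω hmem
      exact closure_minimal (Set.image_preimage_subset g C) hC this

/-- Convergence in law along a reparametrization of the index. -/
lemma TendstoInDistribution.comp_tendsto {ι κ E : Type*} {Ω Ω' : Type*} {mΩ : MeasurableSpace Ω}
    {mΩ' : MeasurableSpace Ω'} {μ : Measure Ω} [IsProbabilityMeasure μ] {μ' : Measure Ω'}
    [IsProbabilityMeasure μ'] [TopologicalSpace E] [MeasurableSpace E] [OpensMeasurableSpace E]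
    {X : ι → Ω → E} {Z : Ω' → E} {l : Filter ι} {l' : Filter κ} {φ : κ → ι}
    (h : TendstoInDistribution X l Z (fun _ => μ) μ') (hφ : Tendsto φ l' l) :
    TendstoInDistribution (fun k => X (φ k)) l' Z (fun _ => μ) μ' where
  forall_aemeasurable k := h.forall_aemeasurable (φ k)
  aemeasurable_limit := h.aemeasurable_limit
  tendsto := h.tendsto.comp hφ

/-- The upper tail probabilities converge at every level that carries no mass of the limit. -/
lemma TendstoInDistribution.tendsto_measureReal_gt {Ω Ω' : Type*} {mΩ : MeasurableSpace Ω}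
    {mΩ' : MeasurableSpace Ω'} {μ : Measure Ω} [IsProbabilityMeasure μ] {μ' : Measure Ω'}
    [IsProbabilityMeasure μ'] {X : ℕ → Ω → ℝ} {Z : Ω' → ℝ}
    (h : TendstoInDistribution X atTop Z (fun _ => μ) μ') {k : ℝ} (hk : μ' {ω | Z ω = k} = 0) :
    Tendsto (fun n => μ.real {ω | X n ω > k}) atTop (𝓝 (μ'.real {ω | Z ω > k})) := by
  have h1 := ProbabilityMeasure.tendsto_measure_of_null_frontier_of_tendsto' h.tendsto
    (E := Set.Ioi k) (by
      rw [frontier_Ioi]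
      simp only [ProbabilityMeasure.coe_mk]
      rw [Measure.map_apply_of_aemeasurable h.aemeasurable_limit (measurableSet_singleton k)]
      exact hk)
  simp only [ProbabilityMeasure.coe_mk] at h1
  rw [Measure.map_apply_of_aemeasurable h.aemeasurable_limit measurableSet_Ioi] at h1
  have h2 := (ENNReal.tendsto_toReal (measure_ne_top _ _)).comp h1
  refine h2.congr fun n => ?_
  simp only [Function.comp]
  rw [Measure.map_apply_of_aemeasurable (h.forall_aemeasurable n) measurableSet_Ioi]
  rfl

/-! ### The limit law of Fisher's statistic -/

section Limit

variable {Ω' : Type*} [MeasurableSpace Ω'] {ν : Measure Ω'} {d : ℕ} {N : Fin d → Ω' → ℝ}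

lemma ae_pi_stdExp_sum_pos {q : ℕ} (hq : 0 < q) :
    ∀ᵐ x ∂(Measure.pi fun _ : Fin q => stdExp), 0 < ∑ i, x i := by
  have : Nonempty (Fin q) := ⟨⟨0, hq⟩⟩
  rw [pi_stdExp]
  refine (withDensity_absolutelyContinuous _ _).ae_le ?_
  filter_upwards [ae_restrict_mem (measurableSet_posOrthant q)] with x hx
  exact Finset.sum_pos (fun i _ => mem_posOrthant.mp hx i) Finset.univ_nonempty

lemma aemeasurable_periodogram_noise (hN' : ∀ i, HasLaw (N i) (gaussianReal 0 1) ν) :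
    AEMeasurable (fun ω (j : Fin (numFreq d)) => periodogram (fun i => N i ω) ((j : ℕ) + 1)) ν :=
  aemeasurable_pi_lambda _ fun _ => (continuous_periodogram _).measurable.comp_aemeasurable
    (aemeasurable_pi_lambda _ fun i => (hN' i).aemeasurable)

lemma ae_sum_periodogram_noise_pos (hN : iIndepFun N ν)
    (hN' : ∀ i, HasLaw (N i) (gaussianReal 0 1) ν) (hq : 0 < numFreq d) :
    ∀ᵐ ω ∂ν, 0 < ∑ j : Fin (numFreq d), periodogram (fun i => N i ω) ((j : ℕ) + 1) := by
  have h := ae_pi_stdExp_sum_pos hq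
  rw [← map_periodogram_noise hN hN'] at h
  exact ae_of_ae_map (aemeasurable_periodogram_noise hN') h

lemma ae_noise_notMem_vanishingSet (hN : iIndepFun N ν)
    (hN' : ∀ i, HasLaw (N i) (gaussianReal 0 1) ν) (hq : 0 < numFreq d) :
    ∀ᵐ ω ∂ν, (fun i => N i ω) ∉ vanishingSet d := by
  filter_upwards [ae_sum_periodogram_noise_pos hN hN' hq] with ω hω
  rw [mem_vanishingSet_iff]
  exact hω.ne'

lemma lt_fisherG_iff {x : Fin d → ℝ} {k : ℝ} (hq : 0 < numFreq d)
    (hx : 0 < ∑ j : Fin (numFreq d), periodogram x ((j : ℕ) + 1)) :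
    k < fisherG x ↔ ∃ i : Fin (numFreq d),
      k * ∑ j : Fin (numFreq d), periodogram x ((j : ℕ) + 1) < periodogram x ((i : ℕ) + 1) := by
  have : Nonempty (Fin (numFreq d)) := ⟨⟨0, hq⟩⟩
  rw [fisherG, sum_periodogram_eq, lt_div_iff₀ hx, lt_ciSup_iff (Set.finite_range _).bddAbove]

/-- The exact distribution of Fisher's statistic under Gaussian white noise. -/
lemma measureReal_fisherG_noise_gt (hN : iIndepFun N ν)
    (hN' : ∀ i, HasLaw (N i) (gaussianReal 0 1) ν) (hq : 2 ≤ numFreq d) (k : ℝ) :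
    ν.real {ω | fisherG (fun i => N i ω) > k} = fisherTail (numFreq d) k := by
  have := hN.isProbabilityMeasure
  have hq0 : 0 < numFreq d := by omega
  rcases lt_or_ge k 0 with hk | hk
  · rw [fisherTail_eq_one_of_nonpos hq0 hk.le]
    have huniv : {ω | fisherG (fun i => N i ω) > k} = Set.univ := by
      refine Set.eq_univ_of_forall fun ω => hk.trans_le ?_
      exact div_nonneg (Real.iSup_nonneg fun _ => periodogram_nonneg _ _)
        (Finset.sum_nonneg fun _ _ => periodogram_nonneg _ _)
    rw [huniv, probReal_univ]
  · rw [← pi_stdExp_real_exists_exceed hq hk, ← map_periodogram_noise hN hN', Measure.real,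
      Measure.real, Measure.map_apply_of_aemeasurable (aemeasurable_periodogram_noise hN')]
    · congr 1
      refine measure_congr ?_
      filter_upwards [ae_sum_periodogram_noise_pos hN hN' hq0] with ω hω
      exact propext (lt_fisherG_iff hq0 hω)
    · have : {x : Fin (numFreq d) → ℝ | ∃ i, k * ∑ l, x l < x i}
          = ⋃ i, {x | k * ∑ l, x l < x i} := by ext x; simp
      rw [this]
      exact MeasurableSet.iUnion fun i => measurableSet_exceed i k

/-- The limit law has no atoms. -/
lemma measure_fisherG_noise_eq (hN : iIndepFun N ν)
    (hN' : ∀ i, HasLaw (N i) (gaussianReal 0 1) ν) (hq : 2 ≤ numFreq d) (k : ℝ) :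
    ν {ω | fisherG (fun i => N i ω) = k} = 0 := by
  have := hN.isProbabilityMeasure
  have hm : AEMeasurable (fun ω => fisherG fun i => N i ω) ν :=
    measurable_fisherG.comp_aemeasurable (aemeasurable_pi_lambda _ fun i => (hN' i).aemeasurable)
  -- An atom at `k` is contained in `{k' < g ≤ k}`, whose mass is an increment of the continuous
  -- tail function.
  have hbound : ∀ k' < k, ν.real {ω | fisherG (fun i => N i ω) = k}
      ≤ fisherTail (numFreq d) k' - fisherTail (numFreq d) k := by
    intro k' hk'
    rw [← measureReal_fisherG_noise_gt hN hN' hq, ← measureReal_fisherG_noise_gt hN hN' hq,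
      le_sub_iff_add_le, ← measureReal_union₀ (nullMeasurableSet_lt aemeasurable_const hm)]
    · refine measureReal_mono ?_
      rintro ω (hω | hω)
      · exact hk'.trans_eq (Eq.symm hω)
      · exact hk'.trans hω
    · refine (Set.disjoint_left.mpr fun ω hω hω' => ?_).aedisjoint
      exact (ne_of_gt hω') hω
  have hlim : Tendsto (fun k' => fisherTail (numFreq d) k' - fisherTail (numFreq d) k)
      (𝓝[<] k) (𝓝 0) := by
    have h := (((continuous_fisherTail (numFreq d)).tendsto k).sub_const
      (fisherTail (numFreq d) k)).mono_left (nhdsWithin_le_nhds (s := Set.Iio k))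
    rwa [sub_self] at h
  have hle : ν.real {ω | fisherG (fun i => N i ω) = k} ≤ 0 :=
    ge_of_tendsto hlim (eventually_nhdsWithin_of_forall hbound)
  exact (measureReal_eq_zero_iff (measure_ne_top _ _)).mp (le_antisymm hle measureReal_nonneg)

end Limit

/-! ### Convergence of the test statistic and the main theorem. -/

lemma IsPeriodicBinarySeries.measurable_blockMean {Ω : Type*} [MeasurableSpace Ω] {μ : Measure Ω}
    {Y : ℕ → Ω → ℝ} {p : ℕ → ℝ} {r : ℕ} (hY : IsPeriodicBinarySeries μ Y p r) (d n : ℕ) :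
    Measurable (blockMean Y d n) := by
  unfold blockMean
  have := hY.measurable
  fun_prop

/-- Fisher's statistic of the block means converges in law to that of Gaussian white noise. -/
lemma IsPeriodicBinarySeries.tendstoInDistribution_fisherF
    {Ω : Type*} [MeasurableSpace Ω] {μ : Measure Ω} [IsProbabilityMeasure μ]
    {Y : ℕ → Ω → ℝ} {p : ℕ → ℝ} {r d : ℕ}
    (hY : IsPeriodicBinarySeries μ Y p r) (hd : 0 < d) (hrd : Nat.Coprime r d)
    {Ω' : Type*} [MeasurableSpace Ω'] {ν : Measure Ω'} [IsProbabilityMeasure ν]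
    {N : Fin d → Ω' → ℝ} (hN : iIndepFun N ν) (hN' : ∀ i, HasLaw (N i) (gaussianReal 0 1) ν) :
    TendstoInDistribution (fun (n : ℕ) ω => fisherF (blockMean Y d n ω)) atTop
      (fun ω => fisherG (fun i => N i ω)) (fun _ => μ) ν := by
  simp_rw [fisherF_eq_fisherG]
  rcases Nat.eq_zero_or_pos (numFreq d) with hq | hq
  · simp_rw [fisherG_eq_zero_of_numFreq_eq_zero hq]
    exact tendstoInDistribution_of_identDistrib (X := fun (_ : ℕ) (_ : Ω) => (0 : ℝ)) 0
      (fun _ => IdentDistrib.refl aemeasurable_const)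
      ⟨aemeasurable_const, aemeasurable_const, by simp⟩
  have hv := hY.average_variance_pos
  set c := √((1 / (r : ℝ)) * ∑ k ∈ Finset.range r, p k * (1 - p k)) with hc
  have hc0 : c ≠ 0 := (Real.sqrt_pos.mpr hv).ne'
  set e := (1 / (r : ℝ)) * ∑ k ∈ Finset.range r, p k with he
  have hofLp : Measurable (fun x : EuclideanSpace ℝ (Fin d) => fisherG (WithLp.ofLp x)) :=
    measurable_fisherG.comp (PiLp.continuous_ofLp 2 fun _ : Fin d => ℝ).measurable
  have hscale : ∀ ω, fisherG (fun i => c * N i ω) = fisherG fun i => N i ω := fun ω => by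
    simpa using fisherG_smul_sub_const (fun i => N i ω) hc0 0
  have hcont : ∀ᵐ ω ∂ν, ContinuousAt
      (fun x : EuclideanSpace ℝ (Fin d) => fisherG (WithLp.ofLp x))
      (WithLp.toLp 2 fun i => c * N i ω) := by
    filter_upwards [ae_noise_notMem_vanishingSet hN hN' hq] with ω hω
    refine ContinuousAt.comp (g := fisherG) (f := WithLp.ofLp) ?_
      (PiLp.continuous_ofLp 2 fun _ : Fin d => ℝ).continuousAt
    refine continuousAt_fisherG fun hmem => hω ?_
    rw [mem_vanishingSet_iff] at hmem ⊢
    have h : ∀ j : Fin (numFreq d), periodogram (fun i => c * N i ω) ((j : ℕ) + 1)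
        = c ^ 2 * periodogram (fun i => N i ω) ((j : ℕ) + 1) := fun j => by
      simpa using periodogram_smul_sub_const (fun i => N i ω) c 0 (j := j + 1) (by omega) (by omega)
    simp_rw [h, ← Finset.mul_sum] at hmem
    exact (mul_eq_zero.mp hmem).resolve_left (pow_ne_zero 2 hc0)
  have h := (TendstoInDistribution.comp_tendsto
    (TendstoInDistribution.comp_of_ae_continuousAt
      (hY.tendstoInDistribution_normalizedBlock hd hrd hN hN') hofLp hcont)
    (Nat.tendsto_div_const_atTop hd.ne')).congr (fun _ => ae_eq_refl _) (ae_of_all _ hscale)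
  -- Invariance removes the centring `e` and the factor `√(n / d)`. The factor must be nonzero, so
  -- the identity is claimed only for nonempty blocks, that is, eventually.
  have hmain : ∀ n : ℕ, 0 < n / d → ∀ ω,
      fisherG (WithLp.ofLp (IsPeriodicBinarySeries.normalizedBlock Y d e (n / d) ω))
        = fisherG (blockMean Y d n ω) := by
    intro n hn ω
    have hs : √((n / d : ℕ) : ℝ) ≠ 0 := (Real.sqrt_pos.mpr (by exact_mod_cast hn)).ne'
    exact fisherG_smul_sub_const (blockMean Y d n ω) hs e
  refine ⟨fun n => (measurable_fisherG.comp (hY.measurable_blockMean d n)).aemeasurable,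
    h.aemeasurable_limit, h.tendsto.congr' ?_⟩
  filter_upwards [(Nat.tendsto_div_const_atTop hd.ne').eventually (eventually_gt_atTop 0)]
    with n hn
  apply Subtype.ext
  exact congrArg (μ.map ·) (funext (hmain n hn))

theorem mainTheorem5
    {Ω : Type*} [MeasurableSpace Ω] (μ : Measure Ω) [IsProbabilityMeasure μ]
    (Y : ℕ → Ω → ℝ) (p : ℕ → ℝ) (r d : ℕ)
    (hY : IsPeriodicBinarySeries μ Y p r) (hd : 0 < d) (hrd : Nat.Coprime r d)
    {Ω' : Type*} [MeasurableSpace Ω'] (ν : Measure Ω') [IsProbabilityMeasure ν]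
    (N : Fin d → Ω' → ℝ) (hN : iIndepFun N ν) (hN' : ∀ i, HasLaw (N i) (gaussianReal 0 1) ν) :
    -- the vector of limits lies in `A`
    limitMean p r d ∈ vanishingSet d ∧
    -- the `v_i` are the limiting variances, and they are all equal
    (∀ i : Fin d, Tendsto
      (fun n : ℕ => variance (fun ω => √((n / d : ℕ) : ℝ) * blockMean Y d n ω i) μ)
      atTop (𝓝 (limitVariance μ Y r d i))) ∧
    (∀ i i' : Fin d, limitVariance μ Y r d i = limitVariance μ Y r d i') ∧
    -- `g(N_1, …, N_d)` is almost surely well defined, and is the limit in law of `f(Z^n)`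
    (3 ≤ d → ∀ᵐ ω ∂ν, (fun i => N i ω) ∉ vanishingSet d) ∧
    TendstoInDistribution (fun (n : ℕ) ω => fisherF (blockMean Y d n ω)) atTop
      (fun ω => fisherG (fun i => N i ω)) (fun _ => μ) ν ∧
    -- the power of the test tends to its nominal level
    (∀ α ∈ Set.Ioo (0 : ℝ) 1, ∀ k : ℝ, fisherTail (numFreq d) k = α →
      Tendsto (fun n : ℕ => μ.real {ω | fisherF (blockMean Y d n ω) > k}) atTop (𝓝 α)) := by
  have hlaw := hY.tendstoInDistribution_fisherF hd hrd hN hN'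
  refine ⟨?_, fun i => ?_, fun i i' => ?_, fun hd3 => ?_, hlaw, ?_⟩
  · rw [funext fun i => hY.limitMean_eq hrd i]
    exact const_mem_vanishingSet d _
  · rw [hY.limitVariance_eq hrd]
    refine ((hY.tendsto_average_variance hrd i).comp
      (Nat.tendsto_div_const_atTop hd.ne')).congr fun n => ?_
    exact (hY.variance_sqrt_mul_average i (n / d)).symm
  · rw [hY.limitVariance_eq hrd, hY.limitVariance_eq hrd]
  · exact ae_noise_notMem_vanishingSet hN hN' (by unfold numFreq; omega)
  · rintro α ⟨hα0, hα1⟩ k hk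
    -- For `q = 0` the tail sum is `0` and for `q = 1` it is `1`, so a solution at a level strictly
    -- between them forces `q ≥ 2`.
    have hq : 2 ≤ numFreq d := by
      by_contra hlt
      have h01 : numFreq d = 0 ∨ numFreq d = 1 := by omega
      rcases h01 with h | h <;> rw [h] at hk <;> simp [fisherTail] at hk <;> linarith
    rw [← hk, ← measureReal_fisherG_noise_gt hN hN' hq k]
    exact TendstoInDistribution.tendsto_measureReal_gt hlaw
      (measure_fisherG_noise_eq hN hN' hq k)
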